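/- **Theorem 5.1 (Gradient estimates, $M<0$).** Let $E_i\Subset E_o\subset\mathbb{R}^2$ be two nonempty simply connected bounded domains whose boundaries $\Gamma_i=\partial E_i$ and $\Gamma_o=\partial E_o$ are simple closed smooth curves, and let $\Omega=E_o\setminus\overline{E_i}$. Let $a,b,\alpha,\beta\in\mathbb{R}$ and let $u\in C^2(\Omega)\cap C^1(\overline\Omega)$ be a solution of $$\Delta u=-2\ \text{ in }\Omega,\qquad u=a,\ \ \frac{\partial u}{\partial\nu}=\alpha\ \text{ on }\Gamma_i,\qquad u=b,\ \ \frac{\partial u}{\partial\nu}=\beta\ \text{ on }\Gamma_o,$$ where $\nu$ is the unit normal pointing outside $\Omega$, and suppose that $b<u<a$ in $\Omega$. Suppose that there are $L,M\in\mathbb{R}$ and $0<r_i<r_o$ such that the model function $L-\tfrac12|x|^2+M\log|x|$ solves the same problem, with the same $a,b,\alpha,\beta$, in the annulus $\{r_i<|x|<r_o\}$ (whose inner and outer boundary circles play the roles of $\Gamma_i$ and $\Gamma_o$), and that $$r_i^2\ \ge\ -M\ >\ 0.$$ For $x\in\Omega$ let $\Psi(x)\in[r_i,r_o]$ be the unique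 number with $u(x)=L-\tfrac12\Psi(x)^2+M\log\Psi(x)$, and set $$W=|\nabla u|^2,\qquad W_0=\left(\frac{M-\Psi^2}{\Psi}\right)^2.$$ Then $W\le W_0$ in $\Omega$. Moreover, if $W=W_0$ at some point of $\Omega$, then $(\Omega,u)$ is rotationally symmetric, that is, $\Omega$ is a round annulus $\{r<|x-c|<R\}$ with $0<r<R$, and $u$ depends in $\Omega$ only on $|x-c|$. -/

import Mathlib

open Set Filter Topology Laplacian
open scoped ContDiff

noncomputable section

/-- The Euclidean plane `ℝ²`. -/
abbrev Plane : Type := EuclideanSpace ℝ (Fin 2)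

/-- `Γ` is a simple closed smooth curve: the trace of a smooth regular `1`-periodic
parametrization that is injective on one period. -/
def IsSmoothSimpleClosedCurve (Γ : Set Plane) : Prop :=
  ∃ γ : ℝ → Plane, ContDiff ℝ ∞ γ ∧ Function.Periodic γ 1 ∧ (∀ t, deriv γ t ≠ 0) ∧
    InjOn γ (Ico 0 1) ∧ range γ = Γ

/-- `E` is a nonempty simply connected bounded domain of the plane whose boundary is a simple
closed smooth curve (`IsSimplyConnected` includes nonemptiness and path-connectedness). -/
structure IsSmoothJordanDomain (E : Set Plane) : Prop where
  isOpen : IsOpen E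
  isSimplyConnected : IsSimplyConnected E
  isBounded : Bornology.IsBounded E
  frontier_curve : IsSmoothSimpleClosedCurve (frontier E)

/-- The region `Ω` between the inner domain `Ei` and the outer domain `Eo`. -/
def ringDomain (Ei Eo : Set Plane) : Set Plane := Eo \ closure Ei

/-- `ν` is the unit normal to `∂Ω` at `x` pointing outside `Ω`. -/
structure IsOuterUnitNormal (Ω : Set Plane) (x ν : Plane) : Prop where
  norm_eq_one : ‖ν‖ = 1
  orthogonal : ∀ v ∈ tangentConeAt ℝ (frontier Ω) x, inner ℝ v ν = 0
  outside : ∀ᶠ s : ℝ in 𝓝[>] 0, x + s • ν ∉ closure Ω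
  inside : ∀ᶠ s : ℝ in 𝓝[<] 0, x + s • ν ∈ Ω

/-- `∂u/∂ν = c` at the boundary point `x` of `Ω`, where `ν` is the outer unit normal: the
one-sided derivative of `u` at `x` along the normal line, from inside `Ω`, is `c`. -/
def HasOuterNormalDeriv (Ω : Set Plane) (u : Plane → ℝ) (x : Plane) (c : ℝ) : Prop :=
  ∃ ν : Plane, IsOuterUnitNormal Ω x ν ∧
    HasDerivWithinAt (fun s : ℝ => u (x + s • ν)) c (Iic 0) 0

/-- `(Ω, u)`, with `Ω = Eo \ closure Ei`, is a classical solution (`C²` in `Ω` and `C¹` up to the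
boundary) of the overdetermined problem `Δu = -2` in `Ω`, `u = a` and `∂u/∂ν = α` on `∂Ei`,
`u = b` and `∂u/∂ν = β` on `∂Eo`. Only the values of `u` on `closure Ω` matter. -/
structure SolvesProblem (Ei Eo : Set Plane) (u : Plane → ℝ) (a b α β : ℝ) : Prop where
  inner_domain : IsSmoothJordanDomain Ei
  outer_domain : IsSmoothJordanDomain Eo
  closure_subset : closure Ei ⊆ Eo
  contDiffOn : ContDiffOn ℝ 2 u (ringDomain Ei Eo)
  contDiffOn_closure : ContDiffOn ℝ 1 u (closure (ringDomain Ei Eo))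
  laplacian_eq : ∀ x ∈ ringDomain Ei Eo, Δ u x = -2
  inner_dirichlet : ∀ x ∈ frontier Ei, u x = a
  inner_neumann : ∀ x ∈ frontier Ei, HasOuterNormalDeriv (ringDomain Ei Eo) u x α
  outer_dirichlet : ∀ x ∈ frontier Eo, u x = b
  outer_neumann : ∀ x ∈ frontier Eo, HasOuterNormalDeriv (ringDomain Ei Eo) u x β

/-- The radial profile `ρ ↦ L - ρ² / 2 + M log ρ`. -/
def modelProfile (L M ρ : ℝ) : ℝ := L - ρ ^ 2 / 2 + M * Real.log ρ

/-- The model function `x ↦ L - |x|² / 2 + M log |x|`. -/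
def modelFunction (L M : ℝ) (x : Plane) : ℝ := modelProfile L M ‖x‖

/-- The model function with parameters `L`, `M` solves the problem with data `a`, `b`, `α`, `β`
in the annulus `{ri < |x| < ro}`. -/
def ModelSolves (L M ri ro a b α β : ℝ) : Prop :=
  0 < ri ∧ ri < ro ∧
    SolvesProblem (Metric.ball 0 ri) (Metric.ball 0 ro) (modelFunction L M) a b α β

/-- The pseudo-radial function `Ψ` of `u`: `Ψ x` is the number in `[ri, ro]` with
`u x = L - (Ψ x)² / 2 + M log (Ψ x)`; see `pseudoRadial_iff` for the case `M ≤ 0`. -/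
def pseudoRadial (L M ri ro : ℝ) (u : Plane → ℝ) (x : Plane) : ℝ :=
  Function.invFunOn (modelProfile L M) (Icc ri ro) (u x)

/-- `W = |∇u|²`. -/
def gradSq (u : Plane → ℝ) (x : Plane) : ℝ := ‖gradient u x‖ ^ 2

/-- `W₀ = ((M - Ψ²) / Ψ)²`. -/
def modelGradSq (L M ri ro : ℝ) (u : Plane → ℝ) (x : Plane) : ℝ :=
  ((M - pseudoRadial L M ri ro u x ^ 2) / pseudoRadial L M ri ro u x) ^ 2

/-- `(Ω, u)` is rotationally symmetric: `Ω` is a round annulus, and `u` depends in `Ω` only on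
the distance to its center. -/
def IsRotationallySymmetric (Ω : Set Plane) (u : Plane → ℝ) : Prop :=
  ∃ (c : Plane) (r R : ℝ), 0 < r ∧ r < R ∧ Ω = {x | r < dist x c ∧ dist x c < R} ∧
    ∃ f : ℝ → ℝ, ∀ x ∈ Ω, u x = f (dist x c)

theorem modelProfile_strictAntiOn (L : ℝ) {M : ℝ} (hM : M ≤ 0) :
    StrictAntiOn (modelProfile L M) (Ioi 0) := by
  intro x hx y hy hxy
  have hx' : (0 : ℝ) < x := hx
  have h1 : Real.log x ≤ Real.log y := Real.log_le_log hx' hxy.le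
  have h2 : M * Real.log y ≤ M * Real.log x := mul_le_mul_of_nonpos_left h1 hM
  unfold modelProfile
  nlinarith

/-- For `M ≤ 0` and a value of `u` between those of the profile at `ri` and `ro`, the number `Ψ x`
is the only solution in `[ri, ro]` of its defining equation. -/
theorem pseudoRadial_iff {L M ri ro : ℝ} (hM : M ≤ 0) (hri : 0 < ri) (hro : ri ≤ ro)
    {u : Plane → ℝ} {x : Plane}
    (hx : u x ∈ Icc (modelProfile L M ro) (modelProfile L M ri)) (ρ : ℝ) :
    pseudoRadial L M ri ro u x = ρ ↔ ρ ∈ Icc ri ro ∧ u x = modelProfile L M ρ := by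
  have hpos : ∀ t ∈ Icc ri ro, t ∈ Ioi (0 : ℝ) := fun t ht => hri.trans_le ht.1
  have hc : ContinuousOn (modelProfile L M) (Icc ri ro) := by
    unfold modelProfile
    exact ContinuousOn.add (by fun_prop)
      (continuousOn_const.mul (Real.continuousOn_log.mono fun t ht => (hpos t ht).ne'))
  obtain ⟨t, ht, htu⟩ := intermediate_value_Icc' hro hc hx
  have hex : ∃ t ∈ Icc ri ro, modelProfile L M t = u x := ⟨t, ht, htu⟩
  have hmem := Function.invFunOn_mem hex
  have heq := Function.invFunOn_eq hex
  constructor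
  · rintro rfl
    exact ⟨hmem, heq.symm⟩
  · rintro ⟨hρ, hu⟩
    exact (modelProfile_strictAntiOn L hM).injOn (hpos _ hmem) (hpos _ hρ) (heq.trans hu)

end

/-!
# Gradient comparison for ring-shaped solutions of `Δu = -2`

Write `ρ = Ψ(x)`, `W = |∇u|²`, `W₀ = ((M - ρ²) / ρ)²`, and regard `W₀ = k(u)` as a function of the
value `t = u`. In complex notation `∇u = conj (H - conj z)` with `H` holomorphic, because
`u + |x|² / 2` is harmonic (`exists_isTorsionPotential`). Thus `W` is smooth, `ΔW = 4 (|H'|² + 1)`,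
and at a point where `∇W = s ∇u ≠ 0` one finds `4 |H'|² = (2 + s)²` (`sq_add_sq_of_critical`).

*The estimate.* The equation for `W - W₀` has a zero-order term of the wrong sign, so `W - W₀` is
compared with a positive multiple of a weight `y`, a solution of the linearized equation. It comes
from varying the parameters `L` and `M` of the model at a fixed value of `u`; since `ρ² ≥ -M`, a
suitable combination of the two variations is positive and nonincreasing in `t`, and then it is
strictly log-concave in `t` (`weight_log_concave`). At a positive maximum of `(W - W₀) / y` this
contradicts the second derivative test (`IsTorsionPotential.not_isLocalMax_sub_weight`). Such a
maximum would be interior, since `W - W₀` tends to zero at the boundary: there the gradient of `u` is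
normal, and its length is `|α|` or `|β|`, as it is for the model (`tendsto_gradSq_of_boundary`,
`ModelSolves.data`).

*The equality case.* Where `W - W₀ ≤ 0`, the zero-order term has the right sign, so by the strong
maximum principle (`eqOn_zero_of_laplaceJet`) `W = W₀` holds on a whole connected component of the
ring. There the point `x + ρ² / (ρ² - M) ∇u` does not depend on `x`, and `ρ` is the distance of `x`
to it (`IsTorsionPotential.exists_center`). The component is therefore a round annulus. Its boundary
circles lie on the two boundary curves; a circle inside a simple closed curve is the whole curve
(`IsSmoothSimpleClosedCurve.eq_sphere`), so both domains are discs and the ring is the annulus. In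
this way the connectedness of the ring is never needed.
-/

open Complex (normSq)

/-! ### Second-order jets along lines -/

/-- `φ` is differentiable near `0`, with first derivative `φ₁` and second derivative `φ₂` at `0`. -/
def HasJet {E : Type*} [NormedAddCommGroup E] [NormedSpace ℝ E] (φ : ℝ → E) (φ₁ φ₂ : E) : Prop :=
  ∃ φ' : ℝ → E, (∀ᶠ s in 𝓝 0, HasDerivAt φ (φ' s) s) ∧ φ' 0 = φ₁ ∧ HasDerivAt φ' φ₂ 0

namespace HasJet

variable {E F : Type*} [NormedAddCommGroup E] [NormedSpace ℝ E] [NormedAddCommGroup F]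
  [NormedSpace ℝ F]

theorem congr {φ : ℝ → E} {φ₁ φ₂ φ₁' φ₂' : E} (h : HasJet φ φ₁ φ₂) (h₁ : φ₁ = φ₁')
    (h₂ : φ₂ = φ₂') : HasJet φ φ₁' φ₂' :=
  h₁ ▸ h₂ ▸ h

theorem continuousAt {φ : ℝ → E} {φ₁ φ₂ : E} (h : HasJet φ φ₁ φ₂) : ContinuousAt φ 0 := by
  obtain ⟨φ', h1, -, -⟩ := h
  exact h1.self_of_nhds.continuousAt

theorem add {φ χ : ℝ → E} {φ₁ φ₂ χ₁ χ₂ : E} (hφ : HasJet φ φ₁ φ₂) (hχ : HasJet χ χ₁ χ₂) :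
    HasJet (fun s => φ s + χ s) (φ₁ + χ₁) (φ₂ + χ₂) := by
  obtain ⟨φ', h1, rfl, h2⟩ := hφ
  obtain ⟨χ', k1, rfl, k2⟩ := hχ
  refine ⟨fun s => φ' s + χ' s, ?_, rfl, h2.fun_add k2⟩
  filter_upwards [h1, k1] with s hs ks using hs.fun_add ks

theorem clm_comp (A : E →L[ℝ] F) {φ : ℝ → E} {φ₁ φ₂ : E} (hφ : HasJet φ φ₁ φ₂) :
    HasJet (fun s => A (φ s)) (A φ₁) (A φ₂) := by
  obtain ⟨φ', h1, rfl, h2⟩ := hφ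
  refine ⟨fun s => A (φ' s), ?_, rfl, A.hasFDerivAt.comp_hasDerivAt _ h2⟩
  filter_upwards [h1] with s hs using A.hasFDerivAt.comp_hasDerivAt _ hs

theorem const_mul (c : ℝ) {φ : ℝ → ℝ} {φ₁ φ₂ : ℝ} (hφ : HasJet φ φ₁ φ₂) :
    HasJet (fun s => c * φ s) (c * φ₁) (c * φ₂) := by
  simpa using hφ.clm_comp (c • ContinuousLinearMap.id ℝ ℝ)

theorem sub {φ χ : ℝ → ℝ} {φ₁ φ₂ χ₁ χ₂ : ℝ} (hφ : HasJet φ φ₁ φ₂) (hχ : HasJet χ χ₁ χ₂) :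
    HasJet (fun s => φ s - χ s) (φ₁ - χ₁) (φ₂ - χ₂) := by
  simpa [sub_eq_add_neg] using hφ.add (hχ.const_mul (-1))

theorem mul {φ χ : ℝ → ℝ} {φ₁ φ₂ χ₁ χ₂ : ℝ} (hφ : HasJet φ φ₁ φ₂) (hχ : HasJet χ χ₁ χ₂) :
    HasJet (fun s => φ s * χ s) (φ₁ * χ 0 + φ 0 * χ₁) (φ₂ * χ 0 + 2 * (φ₁ * χ₁) + φ 0 * χ₂) := by
  obtain ⟨φ', h1, rfl, h2⟩ := hφ
  obtain ⟨χ', k1, rfl, k2⟩ := hχ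
  refine ⟨fun s => φ' s * χ s + φ s * χ' s, ?_, rfl, ?_⟩
  · filter_upwards [h1, k1] with s hs ks using hs.fun_mul ks
  · convert (h2.fun_mul k1.self_of_nhds).fun_add (h1.self_of_nhds.fun_mul k2) using 1
    ring

theorem comp {k k₁ φ : ℝ → ℝ} {k₂ φ₁ φ₂ : ℝ} (hφ : HasJet φ φ₁ φ₂)
    (hk : ∀ᶠ t in 𝓝 (φ 0), HasDerivAt k (k₁ t) t) (hk₁ : HasDerivAt k₁ k₂ (φ 0)) :
    HasJet (fun s => k (φ s)) (k₁ (φ 0) * φ₁) (k₂ * φ₁ ^ 2 + k₁ (φ 0) * φ₂) := by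
  have hc := hφ.continuousAt
  obtain ⟨φ', h1, rfl, h2⟩ := hφ
  refine ⟨fun s => k₁ (φ s) * φ' s, ?_, rfl, ?_⟩
  · filter_upwards [h1, hc.eventually hk] with s hs ks using ks.comp s hs
  · refine ((hk₁.comp (0 : ℝ) h1.self_of_nhds).fun_mul h2).congr_deriv ?_
    simp only [Function.comp_apply]
    ring

/-- Along a line, a holomorphic function `f` has the derivatives `f' e` and `f'' e²`. -/
theorem of_differentiableAt {f : ℂ → ℂ} {z : ℂ} (hf : ∀ᶠ w in 𝓝 z, DifferentiableAt ℂ f w) (e : ℂ) :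
    HasJet (fun s : ℝ => f (z + s * e)) (deriv f z * e) (deriv (deriv f) z * e ^ 2) := by
  have hline : ∀ s : ℝ, HasDerivAt (fun s : ℝ => z + s * e) e s := fun s => by
    simpa using ((hasDerivAt_id s).ofReal_comp.mul_const e).const_add z
  have hcont : Tendsto (fun s : ℝ => z + s * e) (𝓝 0) (𝓝 z) := by
    have := (hline 0).continuousAt.tendsto
    simpa using this
  refine ⟨fun s => deriv f (z + s * e) * e, ?_, by simp, ?_⟩
  · filter_upwards [hcont.eventually hf] with s hs
    exact hs.hasDerivAt.comp s (hline s)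
  · have hd : DifferentiableAt ℂ (deriv f) z :=
      (Complex.analyticAt_iff_eventually_differentiableAt.2 hf).deriv.differentiableAt
    have h := HasDerivAt.comp (h₂ := deriv f) (h₂' := deriv (deriv f) z) (0 : ℝ)
      (by simpa using hd.hasDerivAt) (hline 0)
    rw [pow_two, ← mul_assoc]
    exact h.mul_const e

/-- The second derivative test. -/
theorem of_isLocalMax {φ : ℝ → ℝ} {φ₁ φ₂ : ℝ} (hφ : HasJet φ φ₁ φ₂) (h : IsLocalMax φ 0) :
    φ₁ = 0 ∧ φ₂ ≤ 0 := by
  obtain ⟨φ', h1, rfl, h2⟩ := hφ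
  have hz : φ' 0 = 0 := h.hasDerivAt_eq_zero h1.self_of_nhds
  refine ⟨hz, not_lt.1 fun hpos => ?_⟩
  have hd : deriv φ =ᶠ[𝓝 0] φ' := by
    filter_upwards [h1] with s hs using hs.deriv
  have hdd : deriv (deriv φ) 0 = φ₂ := by
    rw [hd.deriv_eq, h2.deriv]
  have hmin : IsLocalMin φ 0 := isLocalMin_of_deriv_deriv_pos (by rw [hdd]; exact hpos)
    (by rw [h1.self_of_nhds.deriv, hz]) h1.self_of_nhds.continuousAt
  -- `φ` is constant near `0`, so its second derivative vanishes.
  have hc : φ =ᶠ[𝓝 0] fun _ => φ 0 := by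
    filter_upwards [hmin, h] with s hs ks using le_antisymm ks hs
  have : deriv φ =ᶠ[𝓝 0] fun _ => 0 := by simpa using hc.deriv
  rw [this.deriv_eq, deriv_const] at hdd
  exact hpos.ne hdd

end HasJet

/-- `f` is twice differentiable along the coordinate lines through `z`, with first derivatives
`fx`, `fy` and Laplacian `lap` at `z`. -/
def HasLaplaceJet (f : ℂ → ℝ) (z : ℂ) (fx fy lap : ℝ) : Prop :=
  ∃ fxx fyy : ℝ, HasJet (fun s : ℝ => f (z + s * (1 : ℂ))) fx fxx ∧
    HasJet (fun s : ℝ => f (z + s * Complex.I)) fy fyy ∧ fxx + fyy = lap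

namespace HasLaplaceJet

theorem add {f g : ℂ → ℝ} {z : ℂ} {fx fy lf gx gy lg : ℝ} (hf : HasLaplaceJet f z fx fy lf)
    (hg : HasLaplaceJet g z gx gy lg) :
    HasLaplaceJet (fun w => f w + g w) z (fx + gx) (fy + gy) (lf + lg) := by
  obtain ⟨f1, f2, hf1, hf2, rfl⟩ := hf
  obtain ⟨g1, g2, hg1, hg2, rfl⟩ := hg
  exact ⟨_, _, hf1.add hg1, hf2.add hg2, by ring⟩

theorem const_mul (c : ℝ) {f : ℂ → ℝ} {z : ℂ} {fx fy lf : ℝ} (hf : HasLaplaceJet f z fx fy lf) :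
    HasLaplaceJet (fun w => c * f w) z (c * fx) (c * fy) (c * lf) := by
  obtain ⟨f1, f2, hf1, hf2, rfl⟩ := hf
  exact ⟨_, _, hf1.const_mul c, hf2.const_mul c, by ring⟩

theorem sub {f g : ℂ → ℝ} {z : ℂ} {fx fy lf gx gy lg : ℝ} (hf : HasLaplaceJet f z fx fy lf)
    (hg : HasLaplaceJet g z gx gy lg) :
    HasLaplaceJet (fun w => f w - g w) z (fx - gx) (fy - gy) (lf - lg) := by
  simpa [sub_eq_add_neg] using hf.add (hg.const_mul (-1))

theorem comp {k k₁ : ℝ → ℝ} {f : ℂ → ℝ} {z : ℂ} {k₂ fx fy lf : ℝ} (hf : HasLaplaceJet f z fx fy lf)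
    (hk : ∀ᶠ t in 𝓝 (f z), HasDerivAt k (k₁ t) t) (hk₁ : HasDerivAt k₁ k₂ (f z)) :
    HasLaplaceJet (fun w => k (f w)) z (k₁ (f z) * fx) (k₁ (f z) * fy)
      (k₂ * (fx ^ 2 + fy ^ 2) + k₁ (f z) * lf) := by
  obtain ⟨f1, f2, hf1, hf2, rfl⟩ := hf
  have h1 := hf1.comp (k := k) (k₁ := k₁) (k₂ := k₂) (by simpa using hk) (by simpa using hk₁)
  have h2 := hf2.comp (k := k) (k₁ := k₁) (k₂ := k₂) (by simpa using hk) (by simpa using hk₁)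
  simp only [Complex.ofReal_zero, zero_mul, add_zero] at h1 h2
  exact ⟨_, _, h1, h2, by ring⟩

theorem of_isLocalMax {f : ℂ → ℝ} {z : ℂ} {fx fy lf : ℝ} (hf : HasLaplaceJet f z fx fy lf)
    (h : IsLocalMax f z) : fx = 0 ∧ fy = 0 ∧ lf ≤ 0 := by
  obtain ⟨f1, f2, hf1, hf2, rfl⟩ := hf
  have hl : ∀ e : ℂ, IsLocalMax (fun s : ℝ => f (z + s * e)) 0 := fun e => by
    have hc : ContinuousAt (fun s : ℝ => z + s * e) 0 := by fun_prop
    exact IsLocalMax.comp_continuous (g := fun s : ℝ => z + s * e) (b := 0)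
      (by simpa using h) hc
  obtain ⟨h1, h2⟩ := hf1.of_isLocalMax (hl 1)
  obtain ⟨h3, h4⟩ := hf2.of_isLocalMax (hl Complex.I)
  exact ⟨h1, h3, by linarith⟩

end HasLaplaceJet

/-! ### The strong maximum principle -/

theorem hasLaplaceJet_normSq_sub (y z : ℂ) :
    HasLaplaceJet (fun w => normSq (w - y)) z (2 * (z - y).re) (2 * (z - y).im) 4 := by
  have hj : ∀ e : ℂ, HasJet (fun s : ℝ => (z + s * e) - y) e 0 := fun e => by
    have h := HasJet.of_differentiableAt (f := fun w => w - y) (z := z)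
      (Eventually.of_forall fun w => by fun_prop) e
    have hd : deriv (fun w : ℂ => w - y) = fun _ => 1 := by
      ext w; simp
    rw [hd] at h
    simpa using h
  have hsq : ∀ e : ℂ, HasJet (fun s : ℝ => normSq ((z + s * e) - y))
      (2 * ((z - y).re * e.re + (z - y).im * e.im)) (2 * (e.re ^ 2 + e.im ^ 2)) := fun e => by
    have hr := (hj e).clm_comp Complex.reCLM
    have hi := (hj e).clm_comp Complex.imCLM
    have h := (hr.mul hr).add (hi.mul hi)
    simp only [Complex.reCLM_apply, Complex.imCLM_apply, Complex.ofReal_zero, zero_mul, add_zero,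
      Complex.zero_re, Complex.zero_im, mul_zero] at h
    convert h using 1
    · ext s
      rw [Complex.normSq_apply]
    · ring
    · ring
  have h1 := hsq 1
  have h2 := hsq Complex.I
  simp only [Complex.one_re, Complex.one_im, Complex.I_re, Complex.I_im] at h1 h2
  exact ⟨_, _, by simpa using h1, by simpa using h2, by norm_num⟩

theorem hasLaplaceJet_exp_neg_mul_normSq_sub (κ : ℝ) (y z : ℂ) :
    HasLaplaceJet (fun w => Real.exp (-κ * normSq (w - y))) z
      (-2 * κ * (z - y).re * Real.exp (-κ * normSq (z - y)))
      (-2 * κ * (z - y).im * Real.exp (-κ * normSq (z - y)))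
      ((4 * κ ^ 2 * normSq (z - y) - 4 * κ) * Real.exp (-κ * normSq (z - y))) := by
  have hd : ∀ t, HasDerivAt (fun t => Real.exp (-κ * t)) (-κ * Real.exp (-κ * t)) t := fun t => by
    have := ((hasDerivAt_id t).const_mul (-κ)).exp
    simpa [mul_comm] using this
  have h := (hasLaplaceJet_normSq_sub y z).comp (k := fun t => Real.exp (-κ * t))
    (Eventually.of_forall hd) ((hd _).const_mul (-κ))
  convert h using 1
  · ring
  · ring
  · rw [Complex.normSq_apply]
    ring

/-- A function `D ≤ 0` cannot satisfy `ΔD ≥ -K |∇D|` near a zero `z` lying on the boundary circle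
of a disc in which, apart from `z`, it is negative: adding a small multiple of Hopf's barrier
`exp (-κ |w - y|²)` would produce an interior maximum. -/
theorem hopf_contact_false {D : ℂ → ℝ} {y z : ℂ} {δ K : ℝ} (hδ : 0 < δ) (hδy : 2 * δ ≤ dist z y)
    (hcont : ContinuousOn D (Metric.closedBall z δ)) (hle : ∀ w ∈ Metric.closedBall z δ, D w ≤ 0)
    (hz : D z = 0)
    (hneg : ∀ w ∈ Metric.closedBall z δ, w ≠ z → dist w y ≤ dist z y → D w < 0)
    (hpde : ∀ w ∈ Metric.ball z δ, ∃ dx dy lap, HasLaplaceJet D w dx dy lap ∧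
      -K * (|dx| + |dy|) ≤ lap) : False := by
  set R := dist z y with hR
  have hRpos : 0 < R := by linarith
  wlog hK : 0 ≤ K generalizing K
  · refine this (K := 0) (fun w hw => ?_) le_rfl
    obtain ⟨dx, dy, lap, h, h'⟩ := hpde w hw
    refine ⟨dx, dy, lap, h, le_trans ?_ h'⟩
    have : 0 ≤ |dx| + |dy| := by positivity
    nlinarith
  -- On the disc `|w - z| < δ` one has `R / 2 ≤ |w - y| ≤ 2 R`.
  set κ : ℝ := 4 * (2 + 4 * K * R) / R ^ 2 with hκ
  have hκpos : 0 < κ := by positivity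
  have hκR : κ * (R ^ 2 / 4) = 2 + 4 * K * R := by rw [hκ]; field_simp
  set v : ℂ → ℝ := fun w => Real.exp (-κ * normSq (w - y)) with hv
  have hvcont : Continuous v := by
    have := Complex.continuous_normSq
    fun_prop
  have hnsq : ∀ w, normSq (w - y) = dist w y ^ 2 := fun w => by
    rw [Complex.normSq_eq_norm_sq, dist_eq_norm]
  have hsc : IsCompact (Metric.sphere z δ ∩ Metric.closedBall y R) :=
    (isCompact_sphere z δ).inter_right Metric.isClosed_closedBall
  have hsub : Metric.sphere z δ ⊆ Metric.closedBall z δ := Metric.sphere_subset_closedBall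
  obtain ⟨η, hη, hηD⟩ : ∃ η > 0, ∀ w ∈ Metric.sphere z δ ∩ Metric.closedBall y R, D w ≤ -η := by
    rcases (Metric.sphere z δ ∩ Metric.closedBall y R).eq_empty_or_nonempty with he | hne
    · exact ⟨1, one_pos, fun w hw => by simp [he] at hw⟩
    · obtain ⟨w, hw, hmax⟩ := hsc.exists_isMaxOn hne (hcont.mono (inter_subset_left.trans hsub))
      have hwz : w ≠ z := by
        rintro rfl
        have := hw.1
        simp at this
        exact hδ.ne this
      exact ⟨-D w, neg_pos.2 (hneg w (hsub hw.1) hwz hw.2), fun x hx => by simpa using hmax hx⟩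
  have hv1 : ∀ w, v w ≤ 1 := fun w => by
    refine Real.exp_le_one_iff.2 ?_
    nlinarith [Complex.normSq_nonneg (w - y)]
  set ε := η / 2 with hε
  have hεpos : 0 < ε := by positivity
  obtain ⟨w, hw, hmax⟩ := (isCompact_closedBall z δ).exists_isMaxOn ⟨z, by simp [hδ.le]⟩
    (f := fun w => D w + ε * v w) (hcont.add (hvcont.const_mul ε).continuousOn)
  have hwz : ε * v z ≤ D w + ε * v w := by simpa [hz] using hmax (Metric.mem_closedBall_self hδ.le)
  have hwball : w ∈ Metric.ball z δ := by
    refine lt_of_le_of_ne (Metric.mem_closedBall.1 hw) fun hwδ => ?_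
    by_cases hwy : dist w y ≤ R
    · have h1 := hηD w ⟨hwδ, hwy⟩
      have h2 := hv1 w
      have h3 : 0 < v z := Real.exp_pos _
      nlinarith
    · push Not at hwy
      have h1 := hle w hw
      have h2 : v w < v z := by
        refine Real.exp_lt_exp.2 ?_
        rw [hnsq, hnsq, ← hR]
        have : R ^ 2 < dist w y ^ 2 := by gcongr
        nlinarith
      nlinarith
  obtain ⟨dx, dy, lap, hjet, hlap⟩ := hpde w hwball
  have hloc : IsLocalMax (fun w => D w + ε * v w) w :=
    hmax.isLocalMax (mem_of_superset (Metric.isOpen_ball.mem_nhds hwball) Metric.ball_subset_closedBall)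
  obtain ⟨e1, e2, e3⟩ :=
    (hjet.add ((hasLaplaceJet_exp_neg_mul_normSq_sub κ y w).const_mul ε)).of_isLocalMax hloc
  set r := dist w y with hr
  have hr1 : R / 2 ≤ r := by
    have h1 : R ≤ dist z w + r := dist_triangle z w y
    have h2 : dist w z < δ := hwball
    rw [dist_comm] at h2
    linarith
  have hr2 : r ≤ 2 * R := by
    have h1 : r ≤ dist w z + R := dist_triangle w z y
    have h2 : dist w z < δ := hwball
    linarith
  have hre : |(w - y).re| ≤ r := by rw [hr, dist_eq_norm]; exact Complex.abs_re_le_norm _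
  have him : |(w - y).im| ≤ r := by rw [hr, dist_eq_norm]; exact Complex.abs_im_le_norm _
  rw [hnsq, ← hr] at e1 e2 e3
  set x := Real.exp (-κ * r ^ 2) with hx
  have hxpos : 0 < x := Real.exp_pos _
  have hdx : |dx| ≤ 2 * κ * r * x * ε := by
    have : dx = 2 * κ * (w - y).re * x * ε := by linarith
    rw [this, abs_mul, abs_mul, abs_mul, abs_of_pos hεpos, abs_of_pos hxpos,
      abs_of_pos (show 0 < 2 * κ by positivity)]
    gcongr
  have hdy : |dy| ≤ 2 * κ * r * x * ε := by
    have : dy = 2 * κ * (w - y).im * x * ε := by linarith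
    rw [this, abs_mul, abs_mul, abs_mul, abs_of_pos hεpos, abs_of_pos hxpos,
      abs_of_pos (show 0 < 2 * κ by positivity)]
    gcongr
  have h4 : K * (|dx| + |dy|) ≤ K * (4 * κ * r * x * ε) := by
    gcongr; linarith
  have h5 : (4 * κ * x * ε) * (κ * r ^ 2 - 1 - K * r) ≤ 0 := by linarith
  have h6 : κ * r ^ 2 - 1 - K * r ≤ 0 := by
    by_contra hcon
    push Not at hcon
    have : 0 < (4 * κ * x * ε) * (κ * r ^ 2 - 1 - K * r) := by positivity
    linarith
  have h7 : κ * (R ^ 2 / 4) ≤ κ * r ^ 2 := by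
    gcongr
    nlinarith
  have h8 : K * r ≤ K * (2 * R) := by gcongr
  nlinarith [mul_nonneg hK hRpos.le]

/-- **Strong maximum principle.** A nonpositive function on a connected open set that satisfies
`ΔD ≥ -K |∇D|` near each of its zeros, with `K` depending on the zero, and that has a zero,
vanishes identically. -/
theorem eqOn_zero_of_laplaceJet {D : ℂ → ℝ} {V : Set ℂ} (hV : IsOpen V) (hconn : IsPreconnected V)
    (hcont : ContinuousOn D V) (hle : ∀ w ∈ V, D w ≤ 0)
    (hpde : ∀ z ∈ V, D z = 0 → ∃ K, ∀ᶠ w in 𝓝 z, ∃ dx dy lap, HasLaplaceJet D w dx dy lap ∧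
      -K * (|dx| + |dy|) ≤ lap) {z₀ : ℂ} (hz₀ : z₀ ∈ V) (h0 : D z₀ = 0) :
    ∀ w ∈ V, D w = 0 := by
  have hopen : IsOpen {z | z ∈ V ∧ D z = 0} := by
    rw [Metric.isOpen_iff]
    rintro z₁ ⟨hz₁, hD₁⟩
    obtain ⟨δ₀, hδ₀, hball₀⟩ := Metric.isOpen_iff.1 hV z₁ hz₁
    set δ := δ₀ / 4 with hδ
    have hδpos : 0 < δ := by positivity
    refine ⟨δ, hδpos, fun y hy => ?_⟩
    have hyV : y ∈ V := hball₀ (Metric.ball_subset_ball (by linarith) hy)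
    refine ⟨hyV, ?_⟩
    by_contra hDy
    have hbV : Metric.closedBall y (2 * δ) ⊆ V := fun w hw => hball₀ <| by
      have h1 : dist w y ≤ 2 * δ := hw
      have h2 : dist y z₁ < δ := hy
      have h3 := dist_triangle w y z₁
      rw [Metric.mem_ball]
      linarith
    have hS : IsCompact (Metric.closedBall y (2 * δ) ∩ D ⁻¹' {0}) :=
      (isCompact_closedBall y (2 * δ)).of_isClosed_subset
        ((hcont.mono hbV).preimage_isClosed_of_isClosed Metric.isClosed_closedBall
          isClosed_singleton) inter_subset_left
    have hz₁S : z₁ ∈ Metric.closedBall y (2 * δ) ∩ D ⁻¹' {0} := by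
      refine ⟨?_, hD₁⟩
      have h2 : dist y z₁ < δ := hy
      rw [Metric.mem_closedBall, dist_comm]
      linarith
    obtain ⟨z, hz, hmin⟩ := hS.exists_isMinOn ⟨z₁, hz₁S⟩ (f := fun w => dist w y) (by fun_prop)
    have hzV := hbV hz.1
    have hDz : D z = 0 := hz.2
    have hRδ : dist z y ≤ δ := by
      have h1 : dist z y ≤ dist z₁ y := hmin hz₁S
      have h2 : dist y z₁ < δ := hy
      rw [dist_comm] at h2
      linarith
    have hzy : z ≠ y := by
      rintro rfl
      exact hDy hDz
    have hdpos : 0 < dist z y := dist_pos.2 hzy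
    have hneg : ∀ w, dist w y < dist z y → D w < 0 := fun w hw => by
      have hwb : w ∈ Metric.closedBall y (2 * δ) := by
        rw [Metric.mem_closedBall]; linarith
      refine lt_of_le_of_ne (hle w (hbV hwb)) fun hDw => ?_
      have : dist z y ≤ dist w y := hmin ⟨hwb, hDw⟩
      linarith
    -- The disc with diameter `[y, z]` touches the zero set at `z` only.
    set y' : ℂ := (y + z) / 2 with hy'
    have hdy' : dist z y' = dist z y / 2 := by
      rw [dist_eq_norm, dist_eq_norm, hy', show z - (y + z) / 2 = (z - y) / 2 by ring]
      simp
    obtain ⟨K, hK⟩ := hpde z hzV hDz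
    obtain ⟨δ₁, hδ₁, hK₁⟩ := Metric.eventually_nhds_iff_ball.1 hK
    obtain ⟨δ₂, hδ₂, hV₂⟩ := Metric.isOpen_iff.1 hV z hzV
    set δ' := min (dist z y / 4) (min δ₁ (δ₂ / 2)) with hδ'
    have hd1 : δ' ≤ dist z y / 4 := min_le_left _ _
    have hd2 : δ' ≤ δ₁ := (min_le_right _ _).trans (min_le_left _ _)
    have hd3 : δ' ≤ δ₂ / 2 := (min_le_right _ _).trans (min_le_right _ _)
    have hδ'pos : 0 < δ' := lt_min (by positivity) (lt_min hδ₁ (by positivity))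
    have hcV : Metric.closedBall z δ' ⊆ V :=
      (Metric.closedBall_subset_ball (by linarith)).trans hV₂
    refine hopf_contact_false (D := D) (y := y') (z := z) (δ := δ') (K := K) hδ'pos
      (by rw [hdy']; linarith) (hcont.mono hcV) (fun w hw => hle w (hcV hw)) hDz
      (fun w _ hwz hwy => hneg w ?_) (fun w hw => hK₁ w (Metric.ball_subset_ball hd2 hw))
    rw [hdy'] at hwy
    have hsq : ∀ p q : ℂ, dist p q ^ 2 = (p.re - q.re) ^ 2 + (p.im - q.im) ^ 2 := fun p q => by
      rw [dist_eq_norm, ← Complex.normSq_eq_norm_sq, Complex.normSq_apply]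
      simp; ring
    have h1 : dist w y' ^ 2 ≤ (dist z y / 2) ^ 2 := by gcongr
    have h2 : 0 < dist w z ^ 2 := by
      have := dist_pos.2 hwz
      positivity
    have h3 : dist w y ^ 2 < dist z y ^ 2 := by
      rw [div_pow] at h1
      rw [hsq] at h1 h2 ⊢
      rw [hsq] at h1 ⊢
      have e1 : y'.re = (y.re + z.re) / 2 := by simp [hy']
      have e2 : y'.im = (y.im + z.im) / 2 := by simp [hy']
      rw [e1, e2] at h1
      nlinarith
    exact lt_of_pow_lt_pow_left₀ 2 dist_nonneg h3
  have hopen' : IsOpen {z | z ∈ V ∧ D z ≠ 0} :=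
    hcont.isOpen_inter_preimage hV isOpen_compl_singleton
  intro w hw
  by_contra hDw
  obtain ⟨x, -, hx1, hx2⟩ := hconn _ _ hopen hopen'
    (fun x hx => by by_cases h : D x = 0; exacts [Or.inl ⟨hx, h⟩, Or.inr ⟨hx, h⟩])
    ⟨z₀, hz₀, hz₀, h0⟩ ⟨w, hw, hw, hDw⟩
  exact hx2.2 hx1.2

/-! ### Calculus of the radial profile -/

theorem hasDerivAt_modelProfile (L M : ℝ) {ρ : ℝ} (hρ : 0 < ρ) :
    HasDerivAt (modelProfile L M) (-((ρ ^ 2 - M) / ρ)) ρ := by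
  have h1 := ((hasDerivAt_const ρ L).sub ((hasDerivAt_pow 2 ρ).div_const 2)).add
    ((Real.hasDerivAt_log hρ.ne').const_mul M)
  refine h1.congr_deriv ?_
  field_simp
  norm_num
  ring

theorem continuousOn_modelProfile (L M : ℝ) : ContinuousOn (modelProfile L M) (Ioi 0) :=
  fun _ hρ => (hasDerivAt_modelProfile L M hρ).continuousAt.continuousWithinAt

/-- `ψ` is, on the open set `I`, a positive local inverse of a radial profile
`ρ ↦ L - ρ² / 2 + M log ρ`, with values in the range `-M ≤ ρ²`. -/
structure IsProfileInverse (M : ℝ) (I : Set ℝ) (ψ : ℝ → ℝ) : Prop where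
  isOpen : IsOpen I
  pos : ∀ t ∈ I, 0 < ψ t
  neg_le_sq : ∀ t ∈ I, -M ≤ ψ t ^ 2
  hasDerivAt : ∀ t ∈ I, HasDerivAt ψ (-(ψ t / (ψ t ^ 2 - M))) t

/-- The squared slope of the profile as a function of the radius; `modelGradSq` is its value at the
pseudo-radial function. -/
noncomputable def slopeSq (M ρ : ℝ) : ℝ := ((M - ρ ^ 2) / ρ) ^ 2

/-- The derivative of `slopeSq` with respect to the value of the profile. -/
noncomputable def slopeSqDeriv (M ρ : ℝ) : ℝ := -2 * (1 + M / ρ ^ 2)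

/-- The second derivative of `slopeSq` with respect to the value of the profile. -/
noncomputable def slopeSqDeriv₂ (M ρ : ℝ) : ℝ := -4 * M / (ρ ^ 2 * (ρ ^ 2 - M))

/-- The weight `y`: the infinitesimal variation of `slopeSq`, at a fixed value of the profile, when
the parameters `L` and `M` of the profile are varied at rates `K : -1` (up to a constant factor). -/
noncomputable def weight (M K ρ : ℝ) : ℝ := (1 + M / ρ ^ 2) * (K - Real.log ρ) + 1 - M / ρ ^ 2

/-- The derivative of `weight` with respect to the value of the profile. -/
noncomputable def weightDeriv (M K ρ : ℝ) : ℝ :=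
  1 / ρ ^ 2 + 2 * M * (K - Real.log ρ) / (ρ ^ 2 * (ρ ^ 2 - M))

/-- The second derivative of `weight` with respect to the value of the profile, in the form given
by the linearized equation. -/
noncomputable def weightDeriv₂ (M K ρ : ℝ) : ℝ :=
  ((2 - 4 * M / ρ ^ 2) * weightDeriv M K ρ - slopeSqDeriv₂ M ρ * weight M K ρ) / slopeSq M ρ

theorem slopeSq_pos {M ρ : ℝ} (hM : M < 0) (hρ : 0 < ρ) : 0 < slopeSq M ρ := by
  have : (M - ρ ^ 2) / ρ ≠ 0 := div_ne_zero (by nlinarith) hρ.ne'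
  unfold slopeSq
  positivity

theorem slopeSqDeriv₂_pos {M ρ : ℝ} (hM : M < 0) (hρ : 0 < ρ) : 0 < slopeSqDeriv₂ M ρ := by
  have h1 : 0 < -4 * M := by linarith
  have h2 : 0 < ρ ^ 2 - M := by nlinarith
  unfold slopeSqDeriv₂
  positivity

/-- The profile itself satisfies the Bernstein identity with equality. -/
theorem slopeSq_ode {M ρ : ℝ} (hM : M < 0) (hρ : 0 < ρ) :
    (2 + slopeSqDeriv M ρ) ^ 2 + 4 + 2 * slopeSqDeriv M ρ = slopeSqDeriv₂ M ρ * slopeSq M ρ := by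
  have h2 : ρ ^ 2 - M ≠ 0 := by nlinarith
  unfold slopeSqDeriv slopeSqDeriv₂ slopeSq
  field_simp
  ring

theorem weight_ode {M K ρ : ℝ} (hM : M < 0) (hρ : 0 < ρ) :
    weightDeriv₂ M K ρ * slopeSq M ρ =
      (2 - 4 * M / ρ ^ 2) * weightDeriv M K ρ - slopeSqDeriv₂ M ρ * weight M K ρ :=
  div_mul_cancel₀ _ (slopeSq_pos hM hρ).ne'

theorem one_le_weight {M K ρ : ℝ} (hM : M < 0) (hρ : 0 < ρ) (hMρ : -M ≤ ρ ^ 2)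
    (hK : Real.log ρ ≤ K) : 1 ≤ weight M K ρ := by
  have h1 : 0 ≤ 1 + M / ρ ^ 2 := by
    rw [← sub_neg_eq_add, ← neg_div, sub_nonneg]
    exact (div_le_one (by positivity)).2 hMρ
  have h2 : M / ρ ^ 2 ≤ 0 := div_nonpos_of_nonpos_of_nonneg hM.le (by positivity)
  unfold weight
  nlinarith [mul_nonneg h1 (sub_nonneg.2 hK)]

theorem weightDeriv_nonpos {M K ρ : ℝ} (hM : M < 0) (hρ : 0 < ρ)
    (hK : ρ ^ 2 - M ≤ -2 * M * (K - Real.log ρ)) : weightDeriv M K ρ ≤ 0 := by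
  have h2 : 0 < ρ ^ 2 - M := by nlinarith
  have : weightDeriv M K ρ =
      ((ρ ^ 2 - M) - (-2 * M * (K - Real.log ρ))) / (ρ ^ 2 * (ρ ^ 2 - M)) := by
    unfold weightDeriv
    field_simp
    ring
  rw [this]
  exact div_nonpos_of_nonpos_of_nonneg (by linarith) (by positivity)

/-- As a function of the value of the profile, the weight is strictly log-concave where it is
nonincreasing. -/
theorem weight_log_concave {M K ρ : ℝ} (hM : M < 0) (hρ : 0 < ρ) (hy : 0 < weight M K ρ)
    (hy' : weightDeriv M K ρ ≤ 0) : weightDeriv₂ M K ρ < 0 := by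
  have h1 : 0 ≤ 2 - 4 * M / ρ ^ 2 := by
    have : 4 * M / ρ ^ 2 ≤ 0 := div_nonpos_of_nonpos_of_nonneg (by linarith) (by positivity)
    linarith
  refine div_neg_of_neg_of_pos ?_ (slopeSq_pos hM hρ)
  nlinarith [mul_pos (slopeSqDeriv₂_pos hM hρ) hy, mul_nonneg h1 (neg_nonneg.2 hy')]

namespace IsProfileInverse

variable {M : ℝ} {I : Set ℝ} {ψ : ℝ → ℝ}

theorem hasDerivAt_comp (h : IsProfileInverse M I ψ) (hM : M < 0) {f : ℝ → ℝ} {d t : ℝ}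
    (ht : t ∈ I) (hf : HasDerivAt f (-((ψ t ^ 2 - M) / ψ t * d)) (ψ t)) :
    HasDerivAt (fun t => f (ψ t)) d t := by
  refine (hf.comp t (h.hasDerivAt t ht)).congr_deriv ?_
  have h1 := h.pos t ht
  have h2 : ψ t ^ 2 - M ≠ 0 := by nlinarith
  field_simp

theorem hasDerivAt_slopeSq (h : IsProfileInverse M I ψ) (hM : M < 0) {t : ℝ} (ht : t ∈ I) :
    HasDerivAt (fun t => slopeSq M (ψ t)) (slopeSqDeriv M (ψ t)) t := by
  refine h.hasDerivAt_comp hM ht ?_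
  have h1 := h.pos t ht
  set ρ := ψ t
  have hd := ((((hasDerivAt_pow 2 ρ).const_sub M).fun_div (hasDerivAt_id ρ) h1.ne').fun_pow 2)
  refine hd.congr_deriv ?_
  have h2 : ρ ≠ 0 := h1.ne'
  simp only [slopeSqDeriv, id, Nat.cast_ofNat, Nat.add_one_sub_one, pow_one, mul_one]
  field_simp
  ring

theorem hasDerivAt_slopeSqDeriv (h : IsProfileInverse M I ψ) (hM : M < 0) {t : ℝ} (ht : t ∈ I) :
    HasDerivAt (fun t => slopeSqDeriv M (ψ t)) (slopeSqDeriv₂ M (ψ t)) t := by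
  refine h.hasDerivAt_comp hM ht ?_
  have h1 := h.pos t ht
  set ρ := ψ t
  have h2 : ρ ^ 2 - M ≠ 0 := by nlinarith
  have hd := ((((hasDerivAt_const ρ M).fun_div (hasDerivAt_pow 2 ρ)
    (by positivity)).const_add 1).const_mul (-2 : ℝ))
  refine hd.congr_deriv ?_
  simp only [slopeSqDeriv₂]
  field_simp
  norm_num
  ring

theorem hasDerivAt_weight (h : IsProfileInverse M I ψ) (hM : M < 0) (K : ℝ) {t : ℝ} (ht : t ∈ I) :
    HasDerivAt (fun t => weight M K (ψ t)) (weightDeriv M K (ψ t)) t := by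
  refine h.hasDerivAt_comp hM ht ?_
  have h1 := h.pos t ht
  set ρ := ψ t
  have h2 : ρ ^ 2 - M ≠ 0 := by nlinarith
  have hq := (hasDerivAt_const ρ M).fun_div (hasDerivAt_pow 2 ρ) (by positivity)
  have hd := (((hq.const_add 1).fun_mul ((Real.hasDerivAt_log h1.ne').const_sub K)).add_const
    (1 : ℝ)).fun_sub hq
  refine hd.congr_deriv ?_
  simp only [weightDeriv]
  field_simp
  norm_num
  ring

theorem hasDerivAt_weightDeriv (h : IsProfileInverse M I ψ) (hM : M < 0) (K : ℝ) {t : ℝ}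
    (ht : t ∈ I) :
    HasDerivAt (fun t => weightDeriv M K (ψ t)) (weightDeriv₂ M K (ψ t)) t := by
  refine h.hasDerivAt_comp hM ht ?_
  have h1 := h.pos t ht
  set ρ := ψ t
  have h2 : ρ ^ 2 - M ≠ 0 := by nlinarith
  have h3 : M - ρ ^ 2 ≠ 0 := by nlinarith
  have hq := (hasDerivAt_const ρ (1 : ℝ)).fun_div (hasDerivAt_pow 2 ρ) (by positivity)
  have hn := ((Real.hasDerivAt_log h1.ne').const_sub K).const_mul (2 * M)
  have hd := hq.fun_add (hn.fun_div
    ((hasDerivAt_pow 2 ρ).fun_mul ((hasDerivAt_pow 2 ρ).sub_const M)) (by positivity))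
  refine hd.congr_deriv ?_
  simp only [weightDeriv₂, weightDeriv, weight, slopeSq, slopeSqDeriv₂]
  rw [show (M - ρ ^ 2) / ρ = -((ρ ^ 2 - M) / ρ) by ring, neg_sq]
  field_simp
  norm_num
  ring

end IsProfileInverse

/-! ### The gradient of a solution as a perturbed holomorphic function -/

/-- `∇U` is, in complex notation, the conjugate of `H z - conj z` with `H` holomorphic in the open
set `V`; these are the solutions of `ΔU = -2` in `V`. -/
structure IsTorsionPotential (V : Set ℂ) (U : ℂ → ℝ) (H : ℂ → ℂ) : Prop where
  isOpen : IsOpen V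
  differentiableAt : ∀ z ∈ V, DifferentiableAt ℂ H z
  hasFDerivAt : ∀ z ∈ V, HasFDerivAt U
    (Complex.reCLM.comp (ContinuousLinearMap.mul ℝ ℂ (H z - starRingEnd ℂ z))) z

/-- The squared gradient of a solution in complex notation. -/
noncomputable def torsionGradSq (H : ℂ → ℂ) (z : ℂ) : ℝ := normSq (H z - starRingEnd ℂ z)

namespace IsTorsionPotential

variable {V : Set ℂ} {U : ℂ → ℝ} {H : ℂ → ℂ}

theorem eventually_differentiableAt (h : IsTorsionPotential V U H) {z : ℂ} (hz : z ∈ V) :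
    ∀ᶠ w in 𝓝 z, DifferentiableAt ℂ H w := by
  filter_upwards [h.isOpen.mem_nhds hz] with w hw using h.differentiableAt w hw

theorem hasJet_gradient (h : IsTorsionPotential V U H) {z : ℂ} (hz : z ∈ V) (e : ℂ) :
    HasJet (fun s : ℝ => H (z + s * e) - starRingEnd ℂ (z + s * e))
      (deriv H z * e - starRingEnd ℂ e) (deriv (deriv H) z * e ^ 2) := by
  have h1 := HasJet.of_differentiableAt (h.eventually_differentiableAt hz) e
  have h2 := (HasJet.of_differentiableAt (f := fun w => w) (z := z)
    (Eventually.of_forall fun w => differentiableAt_id) e).clm_comp (-Complex.conjCLE : ℂ →L[ℝ] ℂ)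
  simpa [sub_eq_add_neg, add_assoc] using h1.add h2

theorem hasLaplaceJet (h : IsTorsionPotential V U H) {z : ℂ} (hz : z ∈ V) :
    HasLaplaceJet U z (H z - starRingEnd ℂ z).re (-(H z - starRingEnd ℂ z).im) (-2) := by
  have key : ∀ e : ℂ, HasJet (fun s : ℝ => U (z + s * e)) ((H z - starRingEnd ℂ z) * e).re
      ((deriv H z * e - starRingEnd ℂ e) * e).re := fun e => by
    have hline : ∀ s : ℝ, HasDerivAt (fun s : ℝ => z + s * e) e s := fun s => by
      simpa using ((hasDerivAt_id s).ofReal_comp.mul_const e).const_add z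
    have hcont : Tendsto (fun s : ℝ => z + s * e) (𝓝 0) (𝓝 z) := by
      have := (hline 0).continuousAt.tendsto
      simpa using this
    refine ⟨fun s : ℝ => ((H (z + s * e) - starRingEnd ℂ (z + s * e)) * e).re, ?_, by simp, ?_⟩
    · filter_upwards [hcont.eventually (h.isOpen.mem_nhds hz)] with s hs
      exact (h.hasFDerivAt _ hs).comp_hasDerivAt s (hline s)
    · obtain ⟨φ', h1, h2, -⟩ := h.hasJet_gradient hz e
      have h3 := h1.self_of_nhds
      rw [h2] at h3
      exact Complex.reCLM.hasFDerivAt.comp_hasDerivAt (0 : ℝ) (h3.mul_const e)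
  refine ⟨_, _, (key 1).congr (by simp) rfl, (key Complex.I).congr (by simp) rfl, ?_⟩
  simp
  ring

/-- The derivatives of `W = |∇U|²`; with `A + iB = H'`, its Laplacian is `4 (A² + B² + 1)`. -/
theorem hasLaplaceJet_gradSq (h : IsTorsionPotential V U H) {z : ℂ} (hz : z ∈ V) {A B P Q : ℝ}
    (hA : (deriv H z).re = A) (hB : (deriv H z).im = B) (hP : (H z - starRingEnd ℂ z).re = P)
    (hQ : (H z - starRingEnd ℂ z).im = Q) :
    HasLaplaceJet (torsionGradSq H) z (2 * (P * (A - 1) + Q * B)) (2 * (-P * B + Q * (A + 1)))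
      (4 * (A ^ 2 + B ^ 2 + 1)) := by
  have key : ∀ e : ℂ, HasJet (fun s : ℝ => torsionGradSq H (z + s * e)) _ _ := fun e =>
    (((h.hasJet_gradient hz e).clm_comp Complex.reCLM).mul
      ((h.hasJet_gradient hz e).clm_comp Complex.reCLM)).add
      (((h.hasJet_gradient hz e).clm_comp Complex.imCLM).mul
      ((h.hasJet_gradient hz e).clm_comp Complex.imCLM))
  simp only [Complex.reCLM_apply, Complex.imCLM_apply, Complex.ofReal_zero, zero_mul, add_zero,
    hP, hQ] at key
  refine ⟨_, _, (key 1).congr ?_ rfl, (key Complex.I).congr ?_ rfl, ?_⟩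
  · simp [hA, hB]
    ring
  · simp [hA, hB]
    ring
  · simp [hA, hB]
    ring

end IsTorsionPotential

/-! ### Comparison of the gradient with that of the model -/

/-- At a critical point of `W - k(U)` the traceless part of the Hessian of `U` is determined by the
slope of `k`: this is where the dimension two enters. -/
theorem sq_add_sq_of_critical {A B P Q k : ℝ} (hW : 0 < P ^ 2 + Q ^ 2)
    (h1 : 2 * (P * (A - 1) + Q * B) = k * P) (h2 : 2 * (-P * B + Q * (A + 1)) = -k * Q) :
    4 * (A ^ 2 + B ^ 2) = (2 + k) ^ 2 := by
  have h3 : 2 * (P * A + Q * B) = (2 + k) * P := by linarith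
  have h4 : 2 * (Q * A - P * B) = -(2 + k) * Q := by linarith
  have h5 : (P ^ 2 + Q ^ 2) * (4 * (A ^ 2 + B ^ 2)) = (P ^ 2 + Q ^ 2) * (2 + k) ^ 2 := by
    calc (P ^ 2 + Q ^ 2) * (4 * (A ^ 2 + B ^ 2))
        = (2 * (P * A + Q * B)) ^ 2 + (2 * (Q * A - P * B)) ^ 2 := by ring
      _ = (P ^ 2 + Q ^ 2) * (2 + k) ^ 2 := by rw [h3, h4]; ring
  exact mul_left_cancel₀ hW.ne' h5

theorem torsionGradSq_eq (H : ℂ → ℂ) (z : ℂ) : torsionGradSq H z =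
    (H z - starRingEnd ℂ z).re ^ 2 + (H z - starRingEnd ℂ z).im ^ 2 := by
  rw [torsionGradSq, Complex.normSq_apply]
  ring

namespace IsTorsionPotential

variable {V : Set ℂ} {U : ℂ → ℝ} {H : ℂ → ℂ} {M : ℝ} {I : Set ℝ} {ψ : ℝ → ℝ}

/-- The graph of `W` over the values of `U` cannot be touched from above by
`slopeSq + μ * weight` with `μ > 0`. -/
theorem not_isLocalMax_sub_weight (h : IsTorsionPotential V U H) (hψ : IsProfileInverse M I ψ)
    (hM : M < 0) {z : ℂ} (hz : z ∈ V) (hUz : U z ∈ I) {μ K : ℝ} (hμ : 0 < μ)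
    (hy : 0 < weight M K (ψ (U z))) (hy' : weightDeriv M K (ψ (U z)) ≤ 0)
    (heq : torsionGradSq H z = slopeSq M (ψ (U z)) + μ * weight M K (ψ (U z))) :
    ¬ IsLocalMax (fun w => torsionGradSq H w -
      (slopeSq M (ψ (U w)) + μ * weight M K (ψ (U w)))) z := by
  intro hmax
  have hk : ∀ t ∈ I, HasDerivAt (fun t => slopeSq M (ψ t) + μ * weight M K (ψ t))
      (slopeSqDeriv M (ψ t) + μ * weightDeriv M K (ψ t)) t := fun t ht =>
    (hψ.hasDerivAt_slopeSq hM ht).fun_add ((hψ.hasDerivAt_weight hM K ht).const_mul μ)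
  have hk₁ : HasDerivAt (fun t => slopeSqDeriv M (ψ t) + μ * weightDeriv M K (ψ t))
      (slopeSqDeriv₂ M (ψ (U z)) + μ * weightDeriv₂ M K (ψ (U z))) (U z) :=
    (hψ.hasDerivAt_slopeSqDeriv hM hUz).fun_add
      ((hψ.hasDerivAt_weightDeriv hM K hUz).const_mul μ)
  have hjet := (h.hasLaplaceJet_gradSq hz rfl rfl rfl rfl).sub ((h.hasLaplaceJet hz).comp
    (k := fun t => slopeSq M (ψ t) + μ * weight M K (ψ t))
    (k₁ := fun t => slopeSqDeriv M (ψ t) + μ * weightDeriv M K (ψ t))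
    (eventually_of_mem (hψ.isOpen.mem_nhds hUz) hk) hk₁)
  obtain ⟨e1, e2, e3⟩ := hjet.of_isLocalMax hmax
  have hρ := hψ.pos _ hUz
  have hs := slopeSq_pos hM hρ
  have hode := slopeSq_ode hM hρ
  have hlin := weight_ode (K := K) hM hρ
  have hconc := weight_log_concave hM hρ hy hy'
  rw [torsionGradSq_eq] at heq
  set P := (H z - starRingEnd ℂ z).re
  set Q := (H z - starRingEnd ℂ z).im
  set A := (deriv H z).re
  set B := (deriv H z).im
  set ρ := ψ (U z)
  have hcrit := sq_add_sq_of_critical (A := A) (B := B) (P := P) (Q := Q)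
    (k := slopeSqDeriv M ρ + μ * weightDeriv M K ρ) (by rw [heq]; positivity)
    (by linarith) (by linarith)
  rw [neg_sq, heq] at e3
  have hs1 : 2 - 4 * M / ρ ^ 2 = 2 * (2 + slopeSqDeriv M ρ) + 2 := by
    unfold slopeSqDeriv; ring
  rw [hs1] at hlin
  -- What remains is `μ² (y')² ≤ μ² y'' y`, against the log-concavity of the weight.
  have hfin : μ ^ 2 * weightDeriv M K ρ ^ 2 ≤ μ ^ 2 * (weightDeriv₂ M K ρ * weight M K ρ) := by
    linear_combination e3 - hcrit - hode + μ * hlin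
  have hneg : weightDeriv₂ M K ρ * weight M K ρ < 0 := mul_neg_of_neg_of_pos hconc hy
  have hμ2 : 0 < μ ^ 2 := by positivity
  nlinarith [sq_nonneg (weightDeriv M K ρ), mul_pos hμ2 (neg_pos.2 hneg)]

end IsTorsionPotential

/-- A function on a bounded open set that tends to zero at the boundary and has a positive value
attains a positive maximum. -/
theorem exists_isMaxOn_of_tendsto_zero {F : ℂ → ℝ} {V : Set ℂ} (hV : IsOpen V)
    (hb : Bornology.IsBounded V) (hF : ContinuousOn F V)
    (hfr : ∀ p ∈ frontier V, Tendsto F (𝓝[V] p) (𝓝 0)) {x : ℂ} (hx : x ∈ V) (hpos : 0 < F x) :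
    ∃ y ∈ V, 0 < F y ∧ IsMaxOn F V y := by
  have hcl : IsCompact (V ∩ F ⁻¹' Ici (F x)) := by
    refine Metric.isCompact_of_isClosed_isBounded ?_ (hb.subset inter_subset_left)
    refine isClosed_of_closure_subset fun p hp => ?_
    have hne : (𝓝[V ∩ F ⁻¹' Ici (F x)] p).NeBot := mem_closure_iff_nhdsWithin_neBot.1 hp
    have hge : ∀ᶠ w in 𝓝[V ∩ F ⁻¹' Ici (F x)] p, F x ≤ F w :=
      eventually_nhdsWithin_of_forall fun w hw => hw.2
    by_cases hpV : p ∈ V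
    · refine ⟨hpV, ge_of_tendsto ((hF p hpV).mono_left (nhdsWithin_mono _ inter_subset_left)) hge⟩
    · have hpf : p ∈ frontier V := by
        rw [hV.frontier_eq]
        exact ⟨closure_mono inter_subset_left hp, hpV⟩
      have := ge_of_tendsto ((hfr p hpf).mono_left (nhdsWithin_mono _ inter_subset_left)) hge
      exact absurd hpos (not_lt.2 this)
  obtain ⟨y, hy, hmax⟩ := hcl.exists_isMaxOn ⟨x, hx, le_refl (F x)⟩ (hF.mono inter_subset_left)
  refine ⟨y, hy.1, hpos.trans_le hy.2, fun w hw => ?_⟩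
  by_cases hwx : F x ≤ F w
  · exact hmax ⟨hw, hwx⟩
  · exact (not_le.1 hwx).le.trans hy.2

namespace IsTorsionPotential

variable {V : Set ℂ} {U : ℂ → ℝ} {H : ℂ → ℂ} {M : ℝ} {I : Set ℝ} {ψ : ℝ → ℝ}

theorem continuousOn (h : IsTorsionPotential V U H) : ContinuousOn U V :=
  fun z hz => (h.hasFDerivAt z hz).continuousAt.continuousWithinAt

theorem continuousOn_gradSq (h : IsTorsionPotential V U H) : ContinuousOn (torsionGradSq H) V := by
  have hH : ContinuousOn H V := fun z hz => (h.differentiableAt z hz).continuousAt.continuousWithinAt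
  exact Complex.continuous_normSq.comp_continuousOn
    (hH.sub Complex.continuous_conj.continuousOn)

theorem continuousOn_slopeSq (h : IsTorsionPotential V U H) (hψ : IsProfileInverse M I ψ)
    (hM : M < 0) (hUI : MapsTo U V I) : ContinuousOn (fun z => slopeSq M (ψ (U z))) V :=
  ContinuousOn.comp (g := fun t => slopeSq M (ψ t))
    (fun _ ht => (hψ.hasDerivAt_slopeSq hM ht).continuousAt.continuousWithinAt) h.continuousOn hUI

/-- **Gradient estimate.** If `W` and the squared slope of the profile agree at the boundary, then
`W` is dominated by the squared slope. -/
theorem gradSq_le_slopeSq (h : IsTorsionPotential V U H) (hψ : IsProfileInverse M I ψ) (hM : M < 0)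
    (hb : Bornology.IsBounded V) (hUI : MapsTo U V I) {R : ℝ} (hR : ∀ t ∈ I, ψ t ≤ R)
    (hfr : ∀ p ∈ frontier V,
      Tendsto (fun z => torsionGradSq H z - slopeSq M (ψ (U z))) (𝓝[V] p) (𝓝 0)) :
    ∀ z ∈ V, torsionGradSq H z ≤ slopeSq M (ψ (U z)) := by
  intro z hz
  by_contra! hlt
  -- The smallest `K` for which the weight is known to be positive and monotone up to radius `R`.
  set K := Real.log R + (R ^ 2 - M) / (-2 * M) with hK
  have hM2 : 0 < -2 * M := by linarith
  have hlog : ∀ t ∈ I, Real.log (ψ t) ≤ Real.log R := fun t ht =>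
    Real.log_le_log (hψ.pos t ht) (hR t ht)
  have hy1 : ∀ w ∈ V, 1 ≤ weight M K (ψ (U w)) := fun w hw => by
    have hw' := hUI hw
    refine one_le_weight hM (hψ.pos _ hw') (hψ.neg_le_sq _ hw') ((hlog _ hw').trans ?_)
    have : 0 ≤ (R ^ 2 - M) / (-2 * M) := div_nonneg (by nlinarith [sq_nonneg R]) hM2.le
    linarith
  have hy2 : ∀ w ∈ V, weightDeriv M K (ψ (U w)) ≤ 0 := fun w hw => by
    have hw' := hUI hw
    refine weightDeriv_nonpos hM (hψ.pos _ hw') ?_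
    have h1 : -2 * M * ((R ^ 2 - M) / (-2 * M)) = R ^ 2 - M := mul_div_cancel₀ _ hM2.ne'
    have h2 : ψ (U w) ^ 2 ≤ R ^ 2 := pow_le_pow_left₀ (hψ.pos _ hw').le (hR _ hw') 2
    have h3 : 0 ≤ -2 * M * (Real.log R - Real.log (ψ (U w))) :=
      mul_nonneg hM2.le (sub_nonneg.2 (hlog _ hw'))
    rw [hK]
    linarith
  set D := fun z => torsionGradSq H z - slopeSq M (ψ (U z)) with hD
  set Y := fun z => weight M K (ψ (U z)) with hY
  have hDc : ContinuousOn D V := h.continuousOn_gradSq.sub (h.continuousOn_slopeSq hψ hM hUI)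
  have hYc : ContinuousOn Y V := ContinuousOn.comp (g := fun t => weight M K (ψ t))
    (fun _ ht => (hψ.hasDerivAt_weight hM K ht).continuousAt.continuousWithinAt) h.continuousOn hUI
  have hF0 : ∀ p ∈ frontier V, Tendsto (fun z => D z / Y z) (𝓝[V] p) (𝓝 0) := fun p hp => by
    refine squeeze_zero_norm' (eventually_nhdsWithin_of_forall fun w hw => ?_)
      (by simpa using (hfr p hp).norm)
    rw [norm_div]
    refine div_le_self (norm_nonneg _) ?_
    rw [Real.norm_eq_abs]
    exact (hy1 w hw).trans (le_abs_self _)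
  have hYpos : ∀ w ∈ V, 0 < Y w := fun w hw => one_pos.trans_le (hy1 w hw)
  obtain ⟨x, hx, hpos, hmax⟩ := exists_isMaxOn_of_tendsto_zero h.isOpen hb
    (hDc.div hYc fun w hw => (hYpos w hw).ne') hF0 hz (div_pos (sub_pos.2 hlt) (hYpos z hz))
  set μ := D x / Y x with hμ
  have hDx : D x = μ * Y x := (div_mul_cancel₀ _ (hYpos x hx).ne').symm
  refine h.not_isLocalMax_sub_weight hψ hM hx (hUI hx) (μ := μ) (K := K) hpos (hYpos x hx)
    (hy2 x hx) (by simp only [hD] at hDx; linarith) ?_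
  filter_upwards [h.isOpen.mem_nhds hx] with w hw
  have h1 : D w / Y w ≤ μ := hmax hw
  rw [div_le_iff₀ (hYpos w hw)] at h1
  simp only [hD, hY] at h1 hDx
  linarith

/-- The differential inequality satisfied by `W - W₀` where it is nonpositive. -/
theorem eventually_laplaceJet (h : IsTorsionPotential V U H) (hψ : IsProfileInverse M I ψ)
    (hM : M < 0) (hUI : MapsTo U V I) (hle : ∀ z ∈ V, torsionGradSq H z ≤ slopeSq M (ψ (U z)))
    {z : ℂ} (hz : z ∈ V) (heq : torsionGradSq H z = slopeSq M (ψ (U z))) :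
    ∃ K, ∀ᶠ w in 𝓝 z, ∃ dx dy lap,
      HasLaplaceJet (fun w => torsionGradSq H w - slopeSq M (ψ (U w))) w dx dy lap ∧
        -K * (|dx| + |dy|) ≤ lap := by
  have hVz := h.isOpen.mem_nhds hz
  obtain ⟨θ, hθ, hθz⟩ : ∃ θ > 0, θ ^ 2 < torsionGradSq H z := by
    have hpos : 0 < torsionGradSq H z := by rw [heq]; exact slopeSq_pos hM (hψ.pos _ (hUI hz))
    refine ⟨Real.sqrt (torsionGradSq H z) / 2, by positivity, ?_⟩
    rw [div_pow, Real.sq_sqrt hpos.le]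
    linarith
  have hWz : ∀ᶠ w in 𝓝 z, θ ^ 2 < torsionGradSq H w :=
    (h.continuousOn_gradSq.continuousAt hVz).eventually (lt_mem_nhds hθz)
  refine ⟨4 / θ, ?_⟩
  filter_upwards [hVz, hWz] with w hw hθw
  have hUw := hUI hw
  have hρ := hψ.pos _ hUw
  refine ⟨_, _, _, (h.hasLaplaceJet_gradSq hw rfl rfl rfl rfl).sub ((h.hasLaplaceJet hw).comp
    (k := fun t => slopeSq M (ψ t)) (k₁ := fun t => slopeSqDeriv M (ψ t))
    (eventually_of_mem (hψ.isOpen.mem_nhds hUw) fun t ht => hψ.hasDerivAt_slopeSq hM ht)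
    (hψ.hasDerivAt_slopeSqDeriv hM hUw)), ?_⟩
  have hlew := hle w hw
  have hode := slopeSq_ode hM hρ
  have hc := slopeSqDeriv₂_pos hM hρ
  have hMρ := hψ.neg_le_sq _ hUw
  rw [torsionGradSq_eq] at hlew hθw
  set P := (H w - starRingEnd ℂ w).re
  set Q := (H w - starRingEnd ℂ w).im
  set A := (deriv H w).re
  set B := (deriv H w).im
  set ρ := ψ (U w)
  set k := slopeSqDeriv M ρ with hk
  set c := slopeSqDeriv₂ M ρ
  set dx := 2 * (P * (A - 1) + Q * B) - k * P with hdx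
  set dy := 2 * (-P * B + Q * (A + 1)) - k * -Q with hdy
  set S := P ^ 2 + Q ^ 2 with hS
  -- The Bernstein identity.
  have hid : S * (4 * (A ^ 2 + B ^ 2 + 1) - (c * (P ^ 2 + (-Q) ^ 2) + k * -2)) =
      dx ^ 2 + dy ^ 2 + 2 * (2 + k) * (dx * P - dy * Q) + S * (c * (slopeSq M ρ - S)) := by
    rw [mul_sub c, ← hode, hdx, hdy, hS]
    ring
  have hk2 : 0 ≤ 2 * (2 + k) ∧ 2 * (2 + k) ≤ 4 := by
    have h1 : 2 * (2 + k) = 4 * (-M / ρ ^ 2) := by rw [hk, slopeSqDeriv]; ring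
    have h2 : 0 ≤ -M / ρ ^ 2 := div_nonneg (by linarith) (by positivity)
    have h3 : -M / ρ ^ 2 ≤ 1 := (div_le_one (by positivity)).2 hMρ
    constructor <;> linarith
  set s := Real.sqrt S with hs
  have hSpos : 0 < S := (by positivity : 0 < θ ^ 2).trans hθw
  have hspos : 0 < s := Real.sqrt_pos.2 hSpos
  have hsS : s * s = S := Real.mul_self_sqrt hSpos.le
  have hθs : θ ≤ s := Real.le_sqrt_of_sq_le hθw.le
  have hPs : |P| ≤ s := Real.abs_le_sqrt (by rw [hS]; nlinarith)
  have hQs : |Q| ≤ s := Real.abs_le_sqrt (by rw [hS]; nlinarith)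
  have hcs : |dx * P - dy * Q| ≤ (|dx| + |dy|) * s := by
    calc |dx * P - dy * Q| ≤ |dx * P| + |dy * Q| := abs_sub _ _
      _ = |dx| * |P| + |dy| * |Q| := by rw [abs_mul, abs_mul]
      _ ≤ |dx| * s + |dy| * s := by gcongr
      _ = (|dx| + |dy|) * s := by ring
  have hcross : -(4 * ((|dx| + |dy|) * s)) ≤ 2 * (2 + k) * (dx * P - dy * Q) := by
    have h1 : |2 * (2 + k) * (dx * P - dy * Q)| ≤ 4 * ((|dx| + |dy|) * s) := by
      rw [abs_mul, abs_of_nonneg hk2.1]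
      exact mul_le_mul hk2.2 hcs (abs_nonneg _) (by norm_num)
    exact (abs_le.1 h1).1
  have hzero : 0 ≤ S * (c * (slopeSq M ρ - S)) :=
    mul_nonneg hSpos.le (mul_nonneg hc.le (by linarith))
  set lap := 4 * (A ^ 2 + B ^ 2 + 1) - (c * (P ^ 2 + (-Q) ^ 2) + k * -2)
  have hmain : s * (-(4 * (|dx| + |dy|))) ≤ s * (s * lap) := by
    rw [← mul_assoc s s, hsS, hid]
    nlinarith [sq_nonneg dx, sq_nonneg dy]
  have hmain' := le_of_mul_le_mul_left hmain hspos
  have h1 : -(4 * (|dx| + |dy|)) / s ≤ lap := by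
    rw [div_le_iff₀ hspos]
    linarith
  refine le_trans ?_ h1
  have h2 : 4 * (|dx| + |dy|) / s ≤ 4 * (|dx| + |dy|) / θ := by gcongr
  have e1 : -(4 * (|dx| + |dy|)) / s = -(4 * (|dx| + |dy|) / s) := by ring
  have e2 : -(4 / θ) * (|dx| + |dy|) = -(4 * (|dx| + |dy|) / θ) := by ring
  rw [e1, e2]
  linarith

/-! ### Rigidity -/

/-- If `W` equals the squared slope at one point of a connected set, it does so everywhere. -/
theorem gradSq_eq_slopeSq (h : IsTorsionPotential V U H) (hψ : IsProfileInverse M I ψ) (hM : M < 0)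
    (hUI : MapsTo U V I) (hconn : IsPreconnected V)
    (hle : ∀ z ∈ V, torsionGradSq H z ≤ slopeSq M (ψ (U z))) {z₀ : ℂ} (hz₀ : z₀ ∈ V)
    (heq : torsionGradSq H z₀ = slopeSq M (ψ (U z₀))) :
    ∀ z ∈ V, torsionGradSq H z = slopeSq M (ψ (U z)) := fun z hz =>
  sub_eq_zero.1 <| eqOn_zero_of_laplaceJet h.isOpen hconn
    (h.continuousOn_gradSq.sub (h.continuousOn_slopeSq hψ hM hUI))
    (fun w hw => sub_nonpos.2 (hle w hw))
    (fun _ hw hDw => h.eventually_laplaceJet hψ hM hUI hle hw (sub_eq_zero.1 hDw))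
    hz₀ (sub_eq_zero.2 heq) z hz

/-- In the equality case the normal lines of the level sets all pass, at distance `ψ(U)`, through
one point: the center `z + ψ² / (ψ² - M) ∇U` of curvature of the level sets is constant. -/
theorem exists_center (h : IsTorsionPotential V U H) (hψ : IsProfileInverse M I ψ) (hM : M < 0)
    (hUI : MapsTo U V I) (hconn : IsPreconnected V)
    (heq : ∀ z ∈ V, torsionGradSq H z = slopeSq M (ψ (U z))) :
    ∃ c : ℂ, ∀ z ∈ V, dist z c = ψ (U z) := by
  set κ : ℝ → ℝ := fun ρ => ρ ^ 2 / (ρ ^ 2 - M) with hκ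
  set C : ℂ → ℂ := fun z => z + (κ (ψ (U z)) : ℂ) * starRingEnd ℂ (H z - starRingEnd ℂ z) with hC
  have hder : ∀ z ∈ V, HasFDerivAt C (0 : ℂ →L[ℝ] ℂ) z := fun z hz => by
    have hUz := hUI hz
    have hρ := hψ.pos _ hUz
    have hS : ψ (U z) ^ 2 - M ≠ 0 := by nlinarith
    have hκd : HasDerivAt (fun t => κ (ψ t))
        (2 * M * ψ (U z) ^ 2 / (ψ (U z) ^ 2 - M) ^ 3) (U z) := by
      refine hψ.hasDerivAt_comp hM hUz ?_
      refine ((hasDerivAt_pow 2 _).fun_div ((hasDerivAt_pow 2 _).sub_const M) hS).congr_deriv ?_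
      field_simp
      norm_num
      ring
    obtain ⟨κ₁, hκ₁⟩ : ∃ κ₁, κ₁ = 2 * M * ψ (U z) ^ 2 / (ψ (U z) ^ 2 - M) ^ 3 := ⟨_, rfl⟩
    rw [← hκ₁] at hκd
    have hκU := Complex.ofRealCLM.hasFDerivAt.comp z
      (hκd.hasFDerivAt.comp z (h.hasFDerivAt z hz))
    have hH := (h.differentiableAt z hz).hasDerivAt.hasFDerivAt.restrictScalars ℝ
    have hG := Complex.conjCLE.hasFDerivAt.comp z (hH.sub Complex.conjCLE.hasFDerivAt)
    have hd := (hasFDerivAt_id (𝕜 := ℝ) z).add (hκU.mul hG)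
    -- `W - W₀` vanishes identically near `z`, hence its gradient vanishes.
    have hmax : IsLocalMax (fun w => torsionGradSq H w - slopeSq M (ψ (U w))) z := by
      filter_upwards [h.isOpen.mem_nhds hz] with w hw
      rw [heq w hw, heq z hz, sub_self, sub_self]
    obtain ⟨e1, e2, -⟩ := ((h.hasLaplaceJet_gradSq hz rfl rfl rfl rfl).sub
      ((h.hasLaplaceJet hz).comp (k := fun t => slopeSq M (ψ t))
      (k₁ := fun t => slopeSqDeriv M (ψ t))
      (eventually_of_mem (hψ.isOpen.mem_nhds hUz) fun t ht => hψ.hasDerivAt_slopeSq hM ht)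
      (hψ.hasDerivAt_slopeSqDeriv hM hUz))).of_isLocalMax hmax
    have hW := heq z hz
    rw [torsionGradSq_eq] at hW
    refine hd.congr_fderiv ?_
    have hs := slopeSq_pos hM hρ
    have hP : (H z - starRingEnd ℂ z).re = (H z).re - z.re := by simp
    have hQ : (H z - starRingEnd ℂ z).im = (H z).im + z.im := by simp
    rw [hP, hQ] at hW e1 e2
    set P := (H z).re - z.re
    set Q := (H z).im + z.im
    set A := (deriv H z).re
    set B := (deriv H z).im
    set ρ := ψ (U z)
    have hk : 2 + slopeSqDeriv M ρ = -2 * M / ρ ^ 2 := by unfold slopeSqDeriv; ring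
    have e1' : P * A + Q * B = -M / ρ ^ 2 * P := by linear_combination e1 / 2 + P / 2 * hk
    have e2' : Q * A - P * B = M / ρ ^ 2 * Q := by linear_combination e2 / 2 - Q / 2 * hk
    have hA : slopeSq M ρ * A = -M / ρ ^ 2 * (P ^ 2 - Q ^ 2) := by
      rw [← hW]; linear_combination P * e1' + Q * e2'
    have hB : slopeSq M ρ * B = -M / ρ ^ 2 * (2 * P * Q) := by
      rw [← hW]; linear_combination Q * e1' - P * e2'
    have hκW : 2 * (1 - κ ρ) = -κ₁ * slopeSq M ρ := by
      rw [hκ, hκ₁, slopeSq, ← neg_sub (ρ ^ 2) M]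
      field_simp
      ring
    have hκμ : 2 * (κ ρ * (-M / ρ ^ 2)) = -κ₁ * slopeSq M ρ := by
      rw [hκ, hκ₁, slopeSq, ← neg_sub (ρ ^ 2) M]
      field_simp
    have hκA : 2 * (κ ρ * A) = -κ₁ * (P ^ 2 - Q ^ 2) := by
      refine mul_left_cancel₀ hs.ne' ?_
      linear_combination 2 * κ ρ * hA + (P ^ 2 - Q ^ 2) * hκμ
    have hκB : κ ρ * B = -κ₁ * (P * Q) := by
      refine mul_left_cancel₀ hs.ne' ?_
      linear_combination κ ρ * hB + P * Q * hκμ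
    rw [← hW] at hκW
    refine ContinuousLinearMap.ext fun w => Complex.ext ?_ ?_
    · simp
      linear_combination w.re / 2 * hκW + w.re / 2 * hκA - w.im * hκB
    · simp
      linear_combination w.im / 2 * hκW - w.im / 2 * hκA - w.re * hκB
  obtain ⟨c, hc⟩ := h.isOpen.exists_is_const_of_fderiv_eq_zero hconn
    (fun z hz => (hder z hz).differentiableAt.differentiableWithinAt)
    (fun z hz => (hder z hz).fderiv)
  refine ⟨c, fun z hz => ?_⟩
  have hρ := hψ.pos _ (hUI hz)
  have hS : 0 < ψ (U z) ^ 2 - M := by nlinarith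
  have hW := heq z hz
  rw [torsionGradSq, Complex.normSq_eq_norm_sq, slopeSq] at hW
  have hdist : dist z c = κ (ψ (U z)) * ‖H z - starRingEnd ℂ z‖ := by
    rw [← hc z hz, dist_comm, dist_eq_norm, hC]
    have hκ0 : 0 ≤ κ (ψ (U z)) := by rw [hκ]; positivity
    simp only [add_sub_cancel_left, norm_mul, Complex.norm_real, Real.norm_of_nonneg hκ0,
      RCLike.norm_conj]
  refine (pow_left_inj₀ dist_nonneg hρ.le two_ne_zero).1 ?_
  rw [hdist, mul_pow, hW, hκ, ← neg_sub (ψ (U z) ^ 2) M]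
  field_simp

end IsTorsionPotential

/-! ### Passage from the Euclidean plane to the complex plane -/

/-- The identification of the complex plane with the Euclidean plane. -/
noncomputable def complexToPlane : ℂ ≃ₗᵢ[ℝ] Plane := Complex.orthonormalBasisOneI.repr

theorem laplacian_comp_complexToPlane (u : Plane → ℝ) (z : ℂ) :
    Δ (u ∘ complexToPlane) z = Δ u (complexToPlane z) := by
  rw [InnerProductSpace.laplacian_eq_iteratedFDeriv_orthonormalBasis _ Complex.orthonormalBasisOneI,
    InnerProductSpace.laplacian_eq_iteratedFDeriv_orthonormalBasis _
      (Complex.orthonormalBasisOneI.map complexToPlane)]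
  refine Finset.sum_congr rfl fun i _ => ?_
  have h : iteratedFDeriv ℝ 2 (u ∘ complexToPlane) z =
      (iteratedFDeriv ℝ 2 u (complexToPlane z)).compContinuousLinearMap
        fun _ => (complexToPlane : ℂ →L[ℝ] Plane) := by
    have := (complexToPlane.toContinuousLinearEquiv).iteratedFDerivWithin_comp_right u
      (s := univ) uniqueDiffOn_univ (x := z) (mem_univ _) 2
    simpa [iteratedFDerivWithin_univ] using this
  rw [h]
  simp only [ContinuousMultilinearMap.compContinuousLinearMap_apply]
  congr 1
  ext j
  fin_cases j <;> simp

theorem hasFDerivAt_norm_sq_div_two (z : ℂ) :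
    HasFDerivAt (fun z : ℂ => ‖z‖ ^ 2 / 2) (innerSL ℝ z) z := by
  refine ((hasStrictFDerivAt_norm_sq z).hasFDerivAt.mul_const (2⁻¹ : ℝ)).congr_fderiv ?_
  ext v
  simp
  ring

theorem laplacian_norm_sq_div_two (z : ℂ) : Δ (fun z : ℂ => (‖z‖ ^ 2 / 2 : ℝ)) z = 2 := by
  have h : fderiv ℝ (fun z : ℂ => ‖z‖ ^ 2 / 2) = innerSL ℝ := by
    ext1 z; exact (hasFDerivAt_norm_sq_div_two z).fderiv
  rw [InnerProductSpace.laplacian_eq_iteratedFDeriv_complexPlane]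
  have h1 : fderiv ℝ (⇑(innerSL ℝ : ℂ →L⋆[ℝ] ℂ →L[ℝ] ℝ)) z = innerSL ℝ :=
    (innerSL ℝ : ℂ →L[ℝ] ℂ →L[ℝ] ℝ).fderiv
  simp only [iteratedFDeriv_two_apply, h, h1]
  change inner ℝ (1 : ℂ) 1 + inner ℝ Complex.I Complex.I = (2 : ℝ)
  simp
  norm_num

theorem gradSq_eq_of_hasFDerivAt {u : Plane → ℝ} {z G : ℂ}
    (h : HasFDerivAt (u ∘ complexToPlane) (Complex.reCLM.comp (ContinuousLinearMap.mul ℝ ℂ G)) z) :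
    gradSq u (complexToPlane z) = normSq G := by
  have h1 : HasFDerivAt u ((Complex.reCLM.comp (ContinuousLinearMap.mul ℝ ℂ G)).comp
      (complexToPlane.symm : Plane →L[ℝ] ℂ)) (complexToPlane z) := by
    have h2 : HasFDerivAt (complexToPlane.symm : Plane → ℂ) (complexToPlane.symm : Plane →L[ℝ] ℂ)
      (complexToPlane z) := complexToPlane.symm.toContinuousLinearEquiv.hasFDerivAt
    have h3 := HasFDerivAt.comp (g := u ∘ complexToPlane) (complexToPlane z)
      (by simpa using h) h2
    refine h3.congr_of_eventuallyEq (Eventually.of_forall fun x => ?_)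
    simp
  have h4 : HasGradientAt u (complexToPlane (starRingEnd ℂ G)) (complexToPlane z) := by
    rw [hasGradientAt_iff_hasFDerivAt]
    refine h1.congr_fderiv ?_
    ext v
    obtain ⟨w, rfl⟩ := complexToPlane.surjective v
    simp [LinearIsometryEquiv.inner_map_map, Complex.inner]
    ring
  rw [gradSq, h4.gradient, LinearIsometryEquiv.norm_map, RCLike.norm_conj,
    Complex.normSq_eq_norm_sq]

/-- A classical solution of `Δu = -2` is a torsion potential: `u + |x|² / 2` is harmonic. -/
theorem exists_isTorsionPotential {Ω : Set Plane} {u : Plane → ℝ} (hΩ : IsOpen Ω)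
    (hu : ContDiffOn ℝ 2 u Ω) (hΔ : ∀ x ∈ Ω, Δ u x = -2) :
    ∃ H, IsTorsionPotential (complexToPlane ⁻¹' Ω) (u ∘ complexToPlane) H ∧
      ∀ z ∈ complexToPlane ⁻¹' Ω, torsionGradSq H z = gradSq u (complexToPlane z) := by
  set V := complexToPlane ⁻¹' Ω with hV
  set U := u ∘ complexToPlane with hU
  have hVo : IsOpen V := hΩ.preimage complexToPlane.continuous
  set q : ℂ → ℝ := fun z => ‖z‖ ^ 2 / 2 with hq
  have hqc : ContDiff ℝ 2 q := (contDiff_norm_sq ℝ).div_const 2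
  have huc : ∀ z ∈ V, ContDiffAt ℝ 2 u (complexToPlane z) := fun z hz =>
    hu.contDiffAt (hΩ.mem_nhds hz)
  have hUc : ∀ z ∈ V, ContDiffAt ℝ 2 U z := fun z hz =>
    (huc z hz).comp z complexToPlane.toContinuousLinearEquiv.contDiff.contDiffAt
  have hharm : ∀ z ∈ V, InnerProductSpace.HarmonicAt (U + q) z := fun z hz => by
    refine ⟨(hUc z hz).add hqc.contDiffAt, ?_⟩
    filter_upwards [hVo.mem_nhds hz] with w hw
    rw [(hUc w hw).laplacian_add hqc.contDiffAt, laplacian_comp_complexToPlane,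
      hΔ _ hw, laplacian_norm_sq_div_two]
    norm_num
  set H : ℂ → ℂ := fun z => fderiv ℝ (U + q) z 1 - Complex.I * fderiv ℝ (U + q) z Complex.I with hH
  have hfd : ∀ z ∈ V, HasFDerivAt U
      (Complex.reCLM.comp (ContinuousLinearMap.mul ℝ ℂ (H z - starRingEnd ℂ z))) z := fun z hz => by
    have hd := ((hUc z hz).differentiableAt two_ne_zero).hasFDerivAt
    refine hd.congr_fderiv ?_
    have hHz : H z - starRingEnd ℂ z = fderiv ℝ U z 1 - Complex.I * fderiv ℝ U z Complex.I := by
      have hUq : fderiv ℝ (U + q) z = fderiv ℝ U z + innerSL ℝ z :=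
        (hd.add (hasFDerivAt_norm_sq_div_two z)).fderiv
      simp only [hH, hUq]
      apply Complex.ext <;> simp [Complex.inner]
    rw [hHz]
    ext w
    have hw : w = w.re • (1 : ℂ) + w.im • Complex.I := by
      apply Complex.ext <;> simp
    conv_lhs => rw [hw, map_add, map_smul, map_smul]
    simp
    ring
  refine ⟨H, ⟨hVo, fun z hz => HarmonicAt.differentiableAt_complex_partial (hharm z hz), hfd⟩, fun z hz => ?_⟩
  rw [gradSq_eq_of_hasFDerivAt (hfd z hz), torsionGradSq]

/-! ### The gradient at the boundary -/

theorem gradSq_eq_norm_fderiv (u : Plane → ℝ) (x : Plane) : gradSq u x = ‖fderiv ℝ u x‖ ^ 2 := by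
  rw [gradSq, gradient, LinearIsometryEquiv.norm_map]

theorem exists_boundary_fderiv {Ω : Set Plane} (hΩ : IsOpen Ω) {u : Plane → ℝ} {p : Plane}
    (hp : p ∈ closure Ω) (hu : ContDiffOn ℝ 1 u (closure Ω)) :
    ∃ A : Plane →L[ℝ] ℝ, HasFDerivWithinAt u A (closure Ω) p ∧
      Tendsto (fderiv ℝ u) (𝓝[Ω] p) (𝓝 A) := by
  have h := hu p hp
  rw [show (1 : WithTop ℕ∞) = 0 + 1 by simp,
    contDiffWithinAt_succ_iff_hasFDerivWithinAt (by simp)] at h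
  obtain ⟨v, hv, -, f', hf', hc⟩ := h
  rw [insert_eq_of_mem hp] at hv
  have hpv : p ∈ v := mem_of_mem_nhdsWithin hp hv
  refine ⟨f' p, (hf' p hpv).mono_of_mem_nhdsWithin hv, ?_⟩
  have hΩv : v ∈ 𝓝[Ω] p := nhdsWithin_mono p subset_closure hv
  have hcont : Tendsto f' (𝓝[Ω] p) (𝓝 (f' p)) :=
    hc.continuousWithinAt.mono_left (nhdsWithin_le_of_mem hΩv)
  refine hcont.congr' ?_
  obtain ⟨o, ho, hpo, hov⟩ := mem_nhdsWithin.1 hv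
  filter_upwards [self_mem_nhdsWithin, mem_nhdsWithin_of_mem_nhds (ho.mem_nhds hpo)] with x hx hxo
  have hvx : v ∈ 𝓝 x := mem_of_superset ((ho.inter hΩ).mem_nhds ⟨hxo, hx⟩)
    fun y hy => hov ⟨hy.1, subset_closure hy.2⟩
  exact ((hf' x (mem_of_mem_nhds hvx)).hasFDerivAt hvx).fderiv.symm

/-- On a boundary curve on which `u` is constant, the gradient of `u` is normal, so its length is
the absolute value of the normal derivative. -/
theorem tendsto_gradSq_of_boundary {Ω Γ : Set Plane} (hΩ : IsOpen Ω) {u : Plane → ℝ}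
    (hu : ContDiffOn ℝ 1 u (closure Ω)) (hΓ : IsSmoothSimpleClosedCurve Γ) (hΓΩ : Γ ⊆ frontier Ω)
    {c α : ℝ} (hc : ∀ x ∈ Γ, u x = c) {p : Plane} (hp : p ∈ Γ) (hα : HasOuterNormalDeriv Ω u p α) :
    Tendsto (gradSq u) (𝓝[Ω] p) (𝓝 (α ^ 2)) := by
  have hpΩ : p ∈ closure Ω := frontier_subset_closure (hΓΩ hp)
  obtain ⟨A, hA, hlim⟩ := exists_boundary_fderiv hΩ hpΩ hu
  suffices hnorm : ‖A‖ ^ 2 = α ^ 2 by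
    rw [← hnorm]
    exact (hlim.norm.pow 2).congr fun x => (gradSq_eq_norm_fderiv u x).symm
  obtain ⟨ν, hν, hder⟩ := hα
  obtain ⟨γ, hγ, -, hγ0, -, rfl⟩ := hΓ
  obtain ⟨t, rfl⟩ := hp
  have hγd : HasDerivAt γ (deriv γ t) t := (hγ.differentiable (by simp) t).hasDerivAt
  have hAτ : A (deriv γ t) = 0 := by
    have h1 : HasDerivAt (u ∘ γ) (A (deriv γ t)) t := by
      rw [← hasDerivWithinAt_univ]
      exact hA.comp_hasDerivWithinAt t hγd.hasDerivWithinAt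
        fun s _ => frontier_subset_closure (hΓΩ (mem_range_self s))
    have h2 : u ∘ γ = fun _ => c := funext fun s => hc _ (mem_range_self s)
    rw [h2] at h1
    exact h1.unique (hasDerivAt_const t c)
  have hντ : inner ℝ (deriv γ t) ν = 0 := by
    refine hν.orthogonal _ (tangentConeAt_mono hΓΩ ?_)
    have h1 := (hγd.hasFDerivAt.hasFDerivWithinAt (s := univ)).mapsTo_tangent_cone
      (show (1 : ℝ) ∈ tangentConeAt ℝ univ t by simp)
    simpa using h1
  have hAν : A ν = α := by
    have hline : HasDerivAt (fun s : ℝ => γ t + s • ν) ν 0 := by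
      simpa using ((hasDerivAt_id (0 : ℝ)).smul_const ν).const_add (γ t)
    have hmem : {s : ℝ | γ t + s • ν ∈ closure Ω} ∈ 𝓝[≤] (0 : ℝ) := by
      rw [← Iio_insert, nhdsWithin_insert]
      refine ⟨?_, ?_⟩
      · simpa using hpΩ
      · filter_upwards [hν.inside] with s hs using subset_closure hs
    have h1 : HasDerivWithinAt (fun s : ℝ => u (γ t + s • ν)) (A ν)
        {s : ℝ | γ t + s • ν ∈ closure Ω} 0 :=
      HasFDerivWithinAt.comp_hasDerivWithinAt (l := u) (f := fun s : ℝ => γ t + s • ν)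
        (t := closure Ω) 0 (by simpa using hA) hline.hasDerivWithinAt fun s hs => hs
    exact (uniqueDiffWithinAt_Iic 0).eq_deriv _ (h1.mono_of_mem_nhdsWithin hmem) hder
  set v := (InnerProductSpace.toDual ℝ Plane).symm A with hv
  have hvA : ∀ w, inner ℝ v w = A w := fun w => InnerProductSpace.toDual_symm_apply
  have hvn : ‖v‖ = ‖A‖ := LinearIsometryEquiv.norm_map _ _
  have hτ0 := hγ0 t
  have hν1 : ‖ν‖ ^ 2 = 1 := by rw [hν.norm_eq_one, one_pow]
  rw [← hvA] at hAτ hAν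
  rw [← hvn]
  set τ := deriv γ t
  simp only [PiLp.inner_apply, Fin.sum_univ_two, RCLike.inner_apply, conj_trivial] at hAτ hAν hντ
  rw [EuclideanSpace.real_norm_sq_eq, Fin.sum_univ_two] at hν1 ⊢
  have hdet : v 0 * ν 1 - v 1 * ν 0 = 0 := by
    by_contra hne
    refine hτ0 ?_
    ext i
    fin_cases i
    · refine (mul_eq_zero.1 (?_ : (v 0 * ν 1 - v 1 * ν 0) * τ 0 = 0)).resolve_left hne
      linear_combination ν 1 * hAτ - v 1 * hντ
    · refine (mul_eq_zero.1 (?_ : (v 0 * ν 1 - v 1 * ν 0) * τ 1 = 0)).resolve_left hne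
      linear_combination v 0 * hντ - ν 0 * hAτ
  linear_combination (-(v 0 ^ 2 + v 1 ^ 2)) * hν1 + (v 0 * ν 1 - v 1 * ν 0) * hdet +
    (ν 0 * v 0 + ν 1 * v 1 + α) * hAν

theorem IsOuterUnitNormal.mem_closure {Ω : Set Plane} {x ν : Plane} (h : IsOuterUnitNormal Ω x ν) :
    x ∈ closure Ω := by
  have hc : Tendsto (fun s : ℝ => x + s • ν) (𝓝[<] 0) (𝓝 x) := by
    have : ContinuousAt (fun s : ℝ => x + s • ν) 0 := by fun_prop
    simpa using this.tendsto.mono_left nhdsWithin_le_nhds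
  exact mem_closure_of_tendsto hc h.inside

namespace SolvesProblem

variable {Ei Eo : Set Plane} {u : Plane → ℝ} {a b α β : ℝ}

theorem isOpen_ring (h : SolvesProblem Ei Eo u a b α β) : IsOpen (ringDomain Ei Eo) :=
  h.outer_domain.isOpen.sdiff isClosed_closure

theorem inner_subset_frontier (h : SolvesProblem Ei Eo u a b α β) :
    frontier Ei ⊆ frontier (ringDomain Ei Eo) := fun x hx => by
  obtain ⟨ν, hν, -⟩ := h.inner_neumann x hx
  rw [h.isOpen_ring.frontier_eq]
  exact ⟨hν.mem_closure, fun hx' => hx'.2 (frontier_subset_closure hx)⟩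

theorem outer_subset_frontier (h : SolvesProblem Ei Eo u a b α β) :
    frontier Eo ⊆ frontier (ringDomain Ei Eo) := fun x hx => by
  obtain ⟨ν, hν, -⟩ := h.outer_neumann x hx
  rw [h.isOpen_ring.frontier_eq]
  refine ⟨hν.mem_closure, fun hx' => ?_⟩
  rw [h.outer_domain.isOpen.frontier_eq] at hx
  exact hx.2 hx'.1

theorem frontier_subset (h : SolvesProblem Ei Eo u a b α β) :
    frontier (ringDomain Ei Eo) ⊆ frontier Ei ∪ frontier Eo := fun x hx => by
  rw [h.isOpen_ring.frontier_eq] at hx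
  by_cases hxo : x ∈ Eo
  · left
    rw [h.inner_domain.isOpen.frontier_eq]
    refine ⟨by_contra fun hxi => hx.2 ⟨hxo, hxi⟩, fun hxi => ?_⟩
    obtain ⟨y, hy1, hy2⟩ := mem_closure_iff.1 hx.1 Ei h.inner_domain.isOpen hxi
    exact hy2.2 (subset_closure hy1)
  · right
    rw [h.outer_domain.isOpen.frontier_eq]
    exact ⟨closure_mono sdiff_subset hx.1, hxo⟩

theorem tendsto_gradSq_inner (h : SolvesProblem Ei Eo u a b α β) {p : Plane}
    (hp : p ∈ frontier Ei) : Tendsto (gradSq u) (𝓝[ringDomain Ei Eo] p) (𝓝 (α ^ 2)) :=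
  tendsto_gradSq_of_boundary h.isOpen_ring h.contDiffOn_closure h.inner_domain.frontier_curve
    h.inner_subset_frontier h.inner_dirichlet hp (h.inner_neumann p hp)

theorem tendsto_gradSq_outer (h : SolvesProblem Ei Eo u a b α β) {p : Plane}
    (hp : p ∈ frontier Eo) : Tendsto (gradSq u) (𝓝[ringDomain Ei Eo] p) (𝓝 (β ^ 2)) :=
  tendsto_gradSq_of_boundary h.isOpen_ring h.contDiffOn_closure h.outer_domain.frontier_curve
    h.outer_subset_frontier h.outer_dirichlet hp (h.outer_neumann p hp)

end SolvesProblem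

/-! ### The data of the model -/

theorem gradSq_modelFunction (L M : ℝ) {x : Plane} (hx : x ≠ 0) :
    gradSq (modelFunction L M) x = slopeSq M ‖x‖ := by
  have hn : 0 < ‖x‖ := norm_pos_iff.2 hx
  have hd : HasFDerivAt (modelFunction L M) ((-1 + M / ‖x‖ ^ 2) • innerSL ℝ x) x := by
    have h1 := (hasStrictFDerivAt_norm_sq x).hasFDerivAt
    have h2 : HasDerivAt (fun t => L - t / 2 + M / 2 * Real.log t)
        (-1 / 2 + M / 2 * (‖x‖ ^ 2)⁻¹) (‖x‖ ^ 2) := by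
      refine (((hasDerivAt_id _).div_const 2).const_sub L |>.fun_add
        ((Real.hasDerivAt_log (by positivity)).const_mul (M / 2))).congr_deriv ?_
      ring
    refine (h2.comp_hasFDerivAt x h1).congr_of_eventuallyEq ?_ |>.congr_fderiv ?_
    · refine Eventually.of_forall fun y => ?_
      simp only [modelFunction, modelProfile, Function.comp_apply, Real.log_pow]
      push_cast
      ring
    · ext v
      simp
      ring
  rw [gradSq_eq_norm_fderiv, hd.fderiv, norm_smul, innerSL_apply_norm, mul_pow, Real.norm_eq_abs,
    sq_abs, slopeSq]
  field_simp
  ring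

theorem tendsto_gradSq_modelFunction (L M : ℝ) {x : Plane} (hx : x ≠ 0) (Ω : Set Plane) :
    Tendsto (gradSq (modelFunction L M)) (𝓝[Ω] x) (𝓝 (slopeSq M ‖x‖)) := by
  have hn : ‖x‖ ≠ 0 := norm_ne_zero_iff.2 hx
  have hc : ContinuousAt (fun y : Plane => slopeSq M ‖y‖) x := by
    unfold slopeSq
    fun_prop (disch := assumption)
  refine (hc.tendsto.mono_left nhdsWithin_le_nhds).congr' ?_
  filter_upwards [mem_nhdsWithin_of_mem_nhds (isOpen_ne.mem_nhds hx)] with y hy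
  exact (gradSq_modelFunction L M hy).symm

theorem ModelSolves.data {L M ri ro a b α β : ℝ} (h : ModelSolves L M ri ro a b α β) :
    a = modelProfile L M ri ∧ b = modelProfile L M ro ∧ α ^ 2 = slopeSq M ri ∧
      β ^ 2 = slopeSq M ro := by
  obtain ⟨hri, hro, hs⟩ := h
  have hpt : ∀ r : ℝ, 0 < r → ∃ x : Plane, ‖x‖ = r ∧ x ∈ frontier (Metric.ball (0 : Plane) r) :=
    fun r hr => by
      obtain ⟨x, hx⟩ := NormedSpace.sphere_nonempty (E := Plane) (x := 0) |>.2 hr.le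
      exact ⟨x, by simpa using hx, by rwa [frontier_ball _ hr.ne']⟩
  obtain ⟨x, hx, hxf⟩ := hpt ri hri
  obtain ⟨y, hy, hyf⟩ := hpt ro (hri.trans hro)
  have hx0 : x ≠ 0 := by rintro rfl; simp at hx; exact hri.ne hx
  have hy0 : y ≠ 0 := by rintro rfl; simp at hy; exact (hri.trans hro).ne hy
  have hxne : (𝓝[ringDomain (Metric.ball 0 ri) (Metric.ball 0 ro)] x).NeBot :=
    mem_closure_iff_nhdsWithin_neBot.1 (frontier_subset_closure (hs.inner_subset_frontier hxf))
  have hyne : (𝓝[ringDomain (Metric.ball 0 ri) (Metric.ball 0 ro)] y).NeBot :=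
    mem_closure_iff_nhdsWithin_neBot.1 (frontier_subset_closure (hs.outer_subset_frontier hyf))
  refine ⟨?_, ?_, ?_, ?_⟩
  · rw [← hs.inner_dirichlet x hxf, modelFunction, hx]
  · rw [← hs.outer_dirichlet y hyf, modelFunction, hy]
  · rw [← hx]
    exact tendsto_nhds_unique (hs.tendsto_gradSq_inner hxf) (tendsto_gradSq_modelFunction L M hx0 _)
  · rw [← hy]
    exact tendsto_nhds_unique (hs.tendsto_gradSq_outer hyf) (tendsto_gradSq_modelFunction L M hy0 _)

/-- The inverse of the radial profile on `[ri, ro]`; `pseudoRadial` is its composition with `u`. -/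
noncomputable def invProfile (L M ri ro t : ℝ) : ℝ :=
  Function.invFunOn (modelProfile L M) (Icc ri ro) t

theorem invProfile_eq_iff {L M ri ro t : ℝ} (hM : M ≤ 0) (hri : 0 < ri) (hro : ri ≤ ro)
    (ht : t ∈ Icc (modelProfile L M ro) (modelProfile L M ri)) (ρ : ℝ) :
    invProfile L M ri ro t = ρ ↔ ρ ∈ Icc ri ro ∧ t = modelProfile L M ρ :=
  pseudoRadial_iff (u := fun _ => t) (x := 0) hM hri hro ht ρ

theorem continuousOn_invFunOn {X Y : Type*} [TopologicalSpace X] [Nonempty X] [TopologicalSpace Y]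
    [T2Space Y] {f : X → Y} {K : Set X} (hK : IsCompact K) (hf : ContinuousOn f K)
    (hinj : InjOn f K) : ContinuousOn (Function.invFunOn f K) (f '' K) := by
  rw [continuousOn_iff_isClosed]
  intro C hC
  refine ⟨f '' (K ∩ C),
    ((hK.inter_right hC).image_of_continuousOn (hf.mono inter_subset_left)).isClosed, ?_⟩
  ext y
  refine and_congr_left fun hy => ⟨fun hyC => ?_, ?_⟩
  · exact ⟨_, ⟨Function.invFunOn_mem hy, hyC⟩, Function.invFunOn_eq hy⟩
  · rintro ⟨x, ⟨hx, hxC⟩, rfl⟩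
    rwa [mem_preimage, hinj.leftInvOn_invFunOn hx]

theorem continuousOn_invProfile {L M ri ro : ℝ} (hM : M ≤ 0) (hri : 0 < ri) (hro : ri ≤ ro) :
    ContinuousOn (invProfile L M ri ro) (Icc (modelProfile L M ro) (modelProfile L M ri)) := by
  have hpos : Icc ri ro ⊆ Ioi 0 := fun t ht => hri.trans_le ht.1
  refine (continuousOn_invFunOn isCompact_Icc ((continuousOn_modelProfile L M).mono hpos)
    ((modelProfile_strictAntiOn L hM).injOn.mono hpos)).mono fun t ht => ?_
  obtain ⟨h1, h2⟩ := (invProfile_eq_iff hM hri hro ht _).1 rfl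
  exact ⟨_, h1, h2.symm⟩

theorem isProfileInverse_invProfile {L M ri ro : ℝ} (hM : M < 0) (hri : 0 < ri) (hro : ri ≤ ro)
    (hMr : -M ≤ ri ^ 2) :
    IsProfileInverse M (Ioo (modelProfile L M ro) (modelProfile L M ri))
      (invProfile L M ri ro) := by
  have key : ∀ t ∈ Ioo (modelProfile L M ro) (modelProfile L M ri),
      invProfile L M ri ro t ∈ Icc ri ro ∧ t = modelProfile L M (invProfile L M ri ro t) :=
    fun t ht => (invProfile_eq_iff hM.le hri hro (Ioo_subset_Icc_self ht) _).1 rfl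
  have hpos : ∀ t ∈ Ioo (modelProfile L M ro) (modelProfile L M ri),
      0 < invProfile L M ri ro t := fun t ht => hri.trans_le (key t ht).1.1
  refine ⟨isOpen_Ioo, hpos, fun t ht => ?_, fun t ht => ?_⟩
  · exact hMr.trans (pow_le_pow_left₀ hri.le (key t ht).1.1 2)
  · have hp := hpos t ht
    have hS : 0 < invProfile L M ri ro t ^ 2 - M := by nlinarith
    have hcont : ContinuousAt (invProfile L M ri ro) t :=
      (continuousOn_invProfile hM.le hri hro).continuousAt (Icc_mem_nhds ht.1 ht.2)
    refine ((hasDerivAt_modelProfile L M hp).of_local_left_inverse hcont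
      (neg_ne_zero.2 (div_pos hS hp).ne') ?_).congr_deriv ?_
    · filter_upwards [isOpen_Ioo.mem_nhds ht] with s hs using (key s hs).2.symm
    · rw [inv_neg, inv_div]

/-! ### Circles, discs and annuli in the plane -/

theorem one_lt_rank_plane : 1 < Module.rank ℝ Plane := by
  rw [← Module.finrank_eq_rank, finrank_euclideanSpace_fin]
  norm_num

/-- A one-dimensional Borsuk–Ulam argument: a circle does not embed in the line. -/
theorem not_injOn_sphere {c : Plane} {r : ℝ} (hr : 0 < r) {g : Plane → ℝ}
    (hg : ContinuousOn g (Metric.sphere c r)) : ¬ InjOn g (Metric.sphere c r) := by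
  intro hinj
  have hanti : ∀ x ∈ Metric.sphere c r, c + c - x ∈ Metric.sphere c r := fun x hx => by
    rw [mem_sphere_iff_norm] at hx ⊢
    rw [← hx, ← norm_neg]
    congr 1
    abel
  have hG : ContinuousOn (fun x => g x - g (c + c - x)) (Metric.sphere c r) :=
    hg.sub (hg.comp (by fun_prop) hanti)
  obtain ⟨x, hx⟩ := NormedSpace.sphere_nonempty (E := Plane) (x := c) |>.2 hr.le
  have hx' := hanti x hx
  have hflip : c + c - (c + c - x) = x := by abel
  have hpre := isPreconnected_sphere one_lt_rank_plane c r
  obtain ⟨y, hy, hy0⟩ : ∃ y ∈ Metric.sphere c r, g y - g (c + c - y) = 0 := by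
    rcases le_total (g x - g (c + c - x)) 0 with h | h
    · exact hpre.intermediate_value hx hx' hG ⟨h, by simp only [hflip]; linarith⟩
    · exact hpre.intermediate_value hx' hx hG ⟨by simp only [hflip]; linarith, h⟩
  have heq := hinj hy (hanti y hy) (sub_eq_zero.1 hy0)
  have h2 : (2 : ℝ) • (y - c) = 0 := by
    rw [two_smul]
    nth_rewrite 1 [heq]
    abel
  have h3 : y - c = 0 := (smul_eq_zero.1 h2).resolve_left two_ne_zero
  rw [mem_sphere_iff_norm, h3, norm_zero] at hy
  exact hr.ne hy

/-- A circle contained in a simple closed curve is the whole curve. -/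
theorem IsSmoothSimpleClosedCurve.eq_sphere {Γ : Set Plane} (hΓ : IsSmoothSimpleClosedCurve Γ)
    {c : Plane} {r : ℝ} (hr : 0 < r) (hsub : Metric.sphere c r ⊆ Γ) : Γ = Metric.sphere c r := by
  obtain ⟨γ, hγ, hper, -, hinj, rfl⟩ := hΓ
  refine Subset.antisymm ?_ hsub
  rintro _ ⟨t₀, rfl⟩
  by_contra ht₀
  have hinj' : InjOn γ (Ico t₀ (t₀ + 1)) := by
    intro s hs t ht hst
    have hfr : ∀ s : ℝ, γ (Int.fract s) = γ s := fun s => by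
      rw [← Int.self_sub_floor]
      simpa using hper.sub_zsmul_eq (x := s) ⌊s⌋
    have h1 : Int.fract s = Int.fract t :=
      hinj ⟨Int.fract_nonneg s, Int.fract_lt_one s⟩ ⟨Int.fract_nonneg t, Int.fract_lt_one t⟩
        (by rw [hfr, hfr, hst])
    obtain ⟨k, hk⟩ := Int.fract_eq_fract.1 h1
    have h2 : (k : ℝ) < 1 := by rw [← hk]; linarith [hs.2, ht.1]
    have h3 : (-1 : ℝ) < k := by rw [← hk]; linarith [hs.1, ht.2]
    have h4 : k = 0 := by
      have h2' : k < 1 := by exact_mod_cast h2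
      have h3' : -1 < k := by exact_mod_cast h3
      omega
    rw [h4] at hk
    push_cast at hk
    linarith
  set K := Icc t₀ (t₀ + 1) ∩ γ ⁻¹' Metric.sphere c r with hK
  have hKc : IsCompact K :=
    isCompact_Icc.inter_right (Metric.isClosed_sphere.preimage hγ.continuous)
  have hKIco : K ⊆ Ico t₀ (t₀ + 1) := fun s hs => by
    refine ⟨hs.1.1, lt_of_le_of_ne hs.1.2 fun h => ht₀ ?_⟩
    have := hs.2
    rwa [mem_preimage, h, hper t₀] at this
  have himg : γ '' K = Metric.sphere c r := by
    refine Subset.antisymm (by rintro _ ⟨s, hs, rfl⟩; exact hs.2) fun x hx => ?_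
    obtain ⟨t, rfl⟩ := hsub hx
    obtain ⟨s, hs, hst⟩ := hper.exists_mem_Ico one_pos t t₀
    exact ⟨s, ⟨Ico_subset_Icc_self hs, by rwa [mem_preimage, ← hst]⟩, hst.symm⟩
  refine not_injOn_sphere (c := c) hr (g := Function.invFunOn γ K) ?_ ?_
  · rw [← himg]
    exact continuousOn_invFunOn hKc hγ.continuous.continuousOn (hinj'.mono hKIco)
  · rw [← himg]
    intro x hx y hy hxy
    rw [← Function.invFunOn_eq hx, hxy, Function.invFunOn_eq hy]

theorem isPreconnected_setOf_dist_mem (c : Plane) {J : Set ℝ} (hJ : IsPreconnected J)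
    (hpos : J ⊆ Ioi 0) : IsPreconnected {x : Plane | dist x c ∈ J} := by
  have himg : {x : Plane | dist x c ∈ J} =
      (fun q : ℝ × Plane => c + q.1 • q.2) '' (J ×ˢ Metric.sphere (0 : Plane) 1) := by
    ext x
    constructor
    · intro hx
      have h0 : 0 < dist x c := hpos hx
      refine ⟨(dist x c, (dist x c)⁻¹ • (x - c)), ⟨hx, ?_⟩, ?_⟩
      · rw [mem_sphere_zero_iff_norm, norm_smul, norm_inv, Real.norm_of_nonneg h0.le,
          ← dist_eq_norm, inv_mul_cancel₀ h0.ne']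
      · simp only [smul_inv_smul₀ h0.ne']
        abel
    · rintro ⟨⟨t, w⟩, ⟨ht, hw⟩, rfl⟩
      have h0 : 0 < t := hpos ht
      rw [mem_sphere_zero_iff_norm] at hw
      simp only [mem_ofPred_eq, dist_eq_norm, add_sub_cancel_left, norm_smul, hw, mul_one,
        Real.norm_of_nonneg h0.le]
      exact ht
  rw [himg]
  exact (hJ.prod (isPreconnected_sphere one_lt_rank_plane 0 1)).image _ (by fun_prop)

/-- A nonempty bounded open set bounded by a circle is a disc. -/
theorem eq_ball_of_frontier_eq_sphere {E : Set Plane} (hE : IsOpen E) (hne : E.Nonempty)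
    (hb : Bornology.IsBounded E) {c : Plane} {r : ℝ} (hr : 0 < r)
    (hfr : frontier E = Metric.sphere c r) : E = Metric.ball c r := by
  have key : ∀ S : Set Plane, IsPreconnected S → Disjoint S (Metric.sphere c r) →
      (S ∩ E).Nonempty → S ⊆ E := fun S hS hd hSE => by
    refine hS.subset_of_closure_inter_subset hE hSE fun x hx => ?_
    by_contra hxE
    refine disjoint_left.1 hd hx.2 ?_
    rw [← hfr, hE.frontier_eq]
    exact ⟨hx.1, hxE⟩
  have hext : Disjoint {x : Plane | dist x c ∈ Ioi r} E := by
    rw [disjoint_iff_inter_eq_empty]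
    by_contra hcon
    have hsub := key _ (isPreconnected_setOf_dist_mem c isPreconnected_Ioi
      fun t ht => hr.trans ht) (disjoint_left.2 fun x hx hx' => (ne_of_gt hx) hx')
      (nonempty_iff_ne_empty.2 hcon)
    obtain ⟨R, hR⟩ := hb.subset_ball c
    set s := max R r + 1 with hs
    have hs0 : 0 ≤ s := by rw [hs]; linarith [le_max_right R r]
    obtain ⟨x, hx⟩ := NormedSpace.sphere_nonempty (E := Plane) (x := c) |>.2 hs0
    rw [Metric.mem_sphere] at hx
    have h1 : dist x c < R := hR (hsub (show r < dist x c by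
      rw [hx, hs]; linarith [le_max_right R r]))
    rw [hx, hs] at h1
    linarith [le_max_left R r]
  have hsub : E ⊆ Metric.ball c r := fun x hx => by
    rcases lt_trichotomy (dist x c) r with h | h | h
    · exact h
    · have : x ∈ frontier E := by rw [hfr]; exact h
      rw [hE.frontier_eq] at this
      exact absurd hx this.2
    · exact absurd hx (disjoint_left.1 hext h)
  refine Subset.antisymm hsub (key _ (convex_ball c r).isPreconnected
    (disjoint_left.2 fun x hx hx' => (ne_of_lt hx) hx') ?_)
  obtain ⟨x, hx⟩ := hne
  exact ⟨x, hsub hx, hx⟩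

theorem sphere_subset_closure_annulus (c : Plane) {ri ro r : ℝ} (hri : 0 < ri) (hro : ri < ro)
    (hr : r ∈ Icc ri ro) :
    Metric.sphere c r ⊆ closure {x | ri < dist x c ∧ dist x c < ro} := fun x hx => by
  have hr0 : 0 < r := hri.trans_le hr.1
  rw [Metric.mem_sphere] at hx
  -- Approach `x` along the ray from `c`.
  have hcont : Continuous fun t : ℝ => c + (t / r) • (x - c) := by fun_prop
  have hx1 : (fun t : ℝ => c + (t / r) • (x - c)) r = x := by
    simp [hr0.ne']
  have hcl : r ∈ closure (Ioo ri ro) := by rwa [closure_Ioo hro.ne]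
  rw [← hx1]
  refine map_mem_closure (f := fun t : ℝ => c + (t / r) • (x - c)) hcont hcl fun t ht => ?_
  have ht0 : 0 < t := hri.trans ht.1
  have hd : dist (c + (t / r) • (x - c)) c = t := by
    rw [dist_eq_norm, add_sub_cancel_left, norm_smul, ← dist_eq_norm, hx, Real.norm_of_nonneg
      (by positivity), div_mul_cancel₀ _ hr0.ne']
  simp only [mem_ofPred_eq, hd]
  exact ht

/-! ### The gradient estimate and the equality case -/

theorem IsTorsionPotential.mono {V V' : Set ℂ} {U : ℂ → ℝ} {H : ℂ → ℂ}
    (h : IsTorsionPotential V U H) (hV' : IsOpen V') (hsub : V' ⊆ V) :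
    IsTorsionPotential V' U H :=
  ⟨hV', fun z hz => h.differentiableAt z (hsub hz), fun z hz => h.hasFDerivAt z (hsub hz)⟩

namespace SolvesProblem

variable {Ei Eo : Set Plane} {u : Plane → ℝ} {a b α β L M ri ro : ℝ}

theorem eq_or_eq_of_mem_frontier (h : SolvesProblem Ei Eo u a b α β) {p : Plane}
    (hp : p ∈ frontier (ringDomain Ei Eo)) : u p = a ∨ u p = b :=
  (h.frontier_subset hp).imp (h.inner_dirichlet p) (h.outer_dirichlet p)

theorem mapsTo_closure (h : SolvesProblem Ei Eo u a b α β)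
    (hbua : ∀ x ∈ ringDomain Ei Eo, b < u x ∧ u x < a) (hba : b ≤ a) :
    MapsTo u (closure (ringDomain Ei Eo)) (Icc b a) := fun x hx => by
  by_cases hxΩ : x ∈ ringDomain Ei Eo
  · exact ⟨(hbua x hxΩ).1.le, (hbua x hxΩ).2.le⟩
  · have hxf : x ∈ frontier (ringDomain Ei Eo) := by
      rw [h.isOpen_ring.frontier_eq]
      exact ⟨hx, hxΩ⟩
    rcases h.eq_or_eq_of_mem_frontier hxf with h1 | h1 <;> rw [h1]
    exacts [right_mem_Icc.2 hba, left_mem_Icc.2 hba]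

/-- The topological part of the rigidity: if the pseudo-radial function is the distance to a point
`c` on one connected component of the ring, that component is a round annulus; its boundary circles
lie on the boundary curves, hence exhaust them, and the ring is the annulus. -/
theorem isRotationallySymmetric (h : SolvesProblem Ei Eo u (modelProfile L M ri)
    (modelProfile L M ro) α β)
    (hbua : ∀ x ∈ ringDomain Ei Eo, modelProfile L M ro < u x ∧ u x < modelProfile L M ri)
    (hM : M ≤ 0) (hri : 0 < ri) (hro : ri < ro) {x₀ c : Plane} (hx₀ : x₀ ∈ ringDomain Ei Eo)
    (hc : ∀ x ∈ connectedComponentIn (ringDomain Ei Eo) x₀,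
      dist x c = invProfile L M ri ro (u x)) :
    IsRotationallySymmetric (ringDomain Ei Eo) u := by
  set Ω := ringDomain Ei Eo with hΩ
  set C := connectedComponentIn Ω x₀ with hCdef
  set ψ := invProfile L M ri ro with hψ
  have hba : modelProfile L M ro < modelProfile L M ri :=
    (hbua x₀ hx₀).1.trans (hbua x₀ hx₀).2
  have hmaps := h.mapsTo_closure hbua hba.le
  have huc : ContinuousOn u (closure Ω) := h.contDiffOn_closure.continuousOn
  have hψu : ContinuousOn (fun x => ψ (u x)) (closure Ω) :=
    (continuousOn_invProfile hM hri hro.le).comp huc hmaps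
  have hψeq : ∀ t ∈ Icc (modelProfile L M ro) (modelProfile L M ri),
      ψ t ∈ Icc ri ro ∧ t = modelProfile L M (ψ t) := fun t ht =>
    (invProfile_eq_iff hM hri hro.le ht _).1 rfl
  have hCΩ : C ⊆ Ω := connectedComponentIn_subset Ω x₀
  have hCpre : IsPreconnected C := isPreconnected_connectedComponentIn
  have hx₀C : x₀ ∈ C := mem_connectedComponentIn hx₀
  have hCopen : IsOpen C := h.isOpen_ring.connectedComponentIn
  have hcl : ∀ x ∈ closure C, dist x c = ψ (u x) := fun x hx => by
    have hne : (𝓝[C] x).NeBot := mem_closure_iff_nhdsWithin_neBot.1 hx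
    have h1 : Tendsto (fun y => ψ (u y)) (𝓝[C] x) (𝓝 (ψ (u x))) :=
      (hψu x (closure_mono hCΩ hx)).mono_left (nhdsWithin_mono x (hCΩ.trans subset_closure))
    have h2 : Tendsto (fun y => dist y c) (𝓝[C] x) (𝓝 (dist x c)) :=
      ((continuous_id.dist continuous_const).tendsto x).mono_left nhdsWithin_le_nhds
    refine tendsto_nhds_unique (h2.congr' ?_) h1
    filter_upwards [self_mem_nhdsWithin] with y hy using hc y hy
  have hends : ∀ ρ ∈ Icc ri ro, ψ (modelProfile L M ρ) = ρ := fun ρ hρ => by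
    have hanti := (modelProfile_strictAntiOn L hM).antitoneOn
    refine (invProfile_eq_iff hM hri hro.le ⟨?_, ?_⟩ ρ).2 ⟨hρ, rfl⟩
    · exact hanti (hri.trans_le hρ.1) (hri.trans hro) hρ.2
    · exact hanti hri (hri.trans_le hρ.1) hρ.1
  have hri' := left_mem_Icc.2 hro.le
  have hro' := right_mem_Icc.2 hro.le
  have hCA : C ⊆ {x | dist x c ∈ Ioo ri ro} := fun x hx => by
    have hux := hbua x (hCΩ hx)
    obtain ⟨h1, h2⟩ := hψeq (u x) ⟨hux.1.le, hux.2.le⟩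
    rw [mem_ofPred_eq, hc x hx]
    refine ⟨lt_of_le_of_ne h1.1 fun he => ?_, lt_of_le_of_ne h1.2 fun he => ?_⟩
    · rw [← he] at h2; exact hux.2.ne h2
    · rw [he] at h2; exact hux.1.ne' h2
  have hAC : {x | dist x c ∈ Ioo ri ro} ⊆ C := by
    refine (isPreconnected_setOf_dist_mem c isPreconnected_Ioo
      fun t ht => hri.trans ht.1).subset_of_closure_inter_subset hCopen ⟨x₀, hCA hx₀C, hx₀C⟩ ?_
    rintro p ⟨hpC, hpA⟩
    by_cases hpΩ : p ∈ Ω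
    · exact (hCpre.subset_closure (subset_insert p C)
        (insert_subset hpC subset_closure)).subset_connectedComponentIn
        (mem_insert_of_mem p hx₀C) (insert_subset hpΩ hCΩ) (mem_insert p C)
    · have hpf : p ∈ frontier Ω := by
        rw [h.isOpen_ring.frontier_eq]
        exact ⟨closure_mono hCΩ hpC, hpΩ⟩
      have hd := hcl p hpC
      rcases h.eq_or_eq_of_mem_frontier hpf with h1 | h1
      · rw [h1, hends ri hri'] at hd
        exact absurd hd hpA.1.ne'
      · rw [h1, hends ro hro'] at hd
        exact absurd hd hpA.2.ne
  have hCeq : C = {x | ri < dist x c ∧ dist x c < ro} := Subset.antisymm hCA hAC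
  have hsphere : ∀ r ∈ Icc ri ro, ∀ x ∈ Metric.sphere c r,
      x ∈ closure C ∧ u x = modelProfile L M r := fun r hr x hx => by
    have h1 : x ∈ closure C := by
      rw [hCeq]
      exact sphere_subset_closure_annulus c hri hro hr hx
    refine ⟨h1, ?_⟩
    rw [(hψeq (u x) (hmaps (closure_mono hCΩ h1))).2, ← hcl x h1, Metric.mem_sphere.1 hx]
  have hinner : Metric.sphere c ri ⊆ frontier Ei := fun x hx => by
    obtain ⟨h1, h2⟩ := hsphere ri hri' x hx
    have hxf : x ∈ frontier Ω := by
      rw [h.isOpen_ring.frontier_eq]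
      exact ⟨closure_mono hCΩ h1, fun hxΩ => (hbua x hxΩ).2.ne h2⟩
    refine (h.frontier_subset hxf).resolve_right fun h3 => hba.ne ?_
    rw [← h2, h.outer_dirichlet x h3]
  have houter : Metric.sphere c ro ⊆ frontier Eo := fun x hx => by
    obtain ⟨h1, h2⟩ := hsphere ro hro' x hx
    have hxf : x ∈ frontier Ω := by
      rw [h.isOpen_ring.frontier_eq]
      exact ⟨closure_mono hCΩ h1, fun hxΩ => (hbua x hxΩ).1.ne' h2⟩
    refine (h.frontier_subset hxf).resolve_left fun h3 => hba.ne ?_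
    rw [← h2, h.inner_dirichlet x h3]
  have hball : ∀ {E : Set Plane} {r : ℝ}, IsSmoothJordanDomain E → 0 < r →
      Metric.sphere c r ⊆ frontier E → E = Metric.ball c r := fun hE hr hsub =>
    eq_ball_of_frontier_eq_sphere hE.isOpen hE.isSimplyConnected.nonempty hE.isBounded hr
      (hE.frontier_curve.eq_sphere hr hsub)
  have hring : Ω = {x | ri < dist x c ∧ dist x c < ro} := by
    rw [hΩ, ringDomain, hball h.inner_domain hri hinner,
      hball h.outer_domain (hri.trans hro) houter, closure_ball c hri.ne']
    ext x
    simp [and_comm]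
  refine ⟨c, ri, ro, hri, hro, hring, modelProfile L M, fun x hx => ?_⟩
  have hxC : x ∈ C := by rwa [hCeq, ← hring]
  rw [hc x hxC]
  exact (hψeq (u x) (hmaps (subset_closure hx))).2

/-- `W - W₀` tends to zero at the boundary. -/
theorem tendsto_gradSq_sub_slopeSq (h : SolvesProblem Ei Eo u (modelProfile L M ri)
    (modelProfile L M ro) α β)
    (hbua : ∀ x ∈ ringDomain Ei Eo, modelProfile L M ro < u x ∧ u x < modelProfile L M ri)
    (hM : M ≤ 0) (hri : 0 < ri) (hro : ri ≤ ro) (hα : α ^ 2 = slopeSq M ri)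
    (hβ : β ^ 2 = slopeSq M ro) {p : Plane} (hp : p ∈ frontier (ringDomain Ei Eo)) :
    Tendsto (fun x => gradSq u x - slopeSq M (invProfile L M ri ro (u x)))
      (𝓝[ringDomain Ei Eo] p) (𝓝 0) := by
  have hanti := (modelProfile_strictAntiOn L hM).antitoneOn
  have hba : modelProfile L M ro ≤ modelProfile L M ri := hanti hri (hri.trans_le hro) hro
  have hmaps := h.mapsTo_closure hbua hba
  have hpc := frontier_subset_closure hp
  have hc : ContinuousOn (fun x => slopeSq M (invProfile L M ri ro (u x)))
      (closure (ringDomain Ei Eo)) := by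
    have h1 : ContinuousOn (slopeSq M) (Icc ri ro) := fun t ht => by
      have ht0 : t ≠ 0 := (hri.trans_le ht.1).ne'
      unfold slopeSq
      exact ContinuousAt.continuousWithinAt (by fun_prop (disch := assumption))
    refine h1.comp ((continuousOn_invProfile hM hri hro).comp h.contDiffOn_closure.continuousOn
      hmaps) fun x hx => ?_
    exact ((invProfile_eq_iff hM hri hro (hmaps hx) _).1 rfl).1
  have hlim : Tendsto (fun x => slopeSq M (invProfile L M ri ro (u x)))
      (𝓝[ringDomain Ei Eo] p) (𝓝 (slopeSq M (invProfile L M ri ro (u p)))) :=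
    (hc p hpc).mono_left (nhdsWithin_mono p subset_closure)
  have hend : ∀ ρ ∈ Icc ri ro, u p = modelProfile L M ρ → invProfile L M ri ro (u p) = ρ :=
    fun ρ hρ hup => (invProfile_eq_iff hM hri hro (hmaps hpc) ρ).2 ⟨hρ, hup⟩
  rcases h.frontier_subset hp with hpi | hpo
  · rw [hend ri (left_mem_Icc.2 hro) (h.inner_dirichlet p hpi), ← hα] at hlim
    simpa using (h.tendsto_gradSq_inner hpi).sub hlim
  · rw [hend ro (right_mem_Icc.2 hro) (h.outer_dirichlet p hpo), ← hβ] at hlim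
    simpa using (h.tendsto_gradSq_outer hpo).sub hlim

end SolvesProblem

theorem theorem5p1 (Ei Eo : Set Plane) (u : Plane → ℝ) (a b α β L M ri ro : ℝ)
    (hu : SolvesProblem Ei Eo u a b α β)
    (hbua : ∀ x ∈ ringDomain Ei Eo, b < u x ∧ u x < a)
    (hmodel : ModelSolves L M ri ro a b α β)
    (hM : 0 < -M) (hri : -M ≤ ri ^ 2) :
    (∀ x ∈ ringDomain Ei Eo, gradSq u x ≤ modelGradSq L M ri ro u x) ∧
      ((∃ x ∈ ringDomain Ei Eo, gradSq u x = modelGradSq L M ri ro u x) →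
        IsRotationallySymmetric (ringDomain Ei Eo) u) := by
  obtain ⟨rfl, rfl, hα, hβ⟩ := hmodel.data
  obtain ⟨hri0, hro, -⟩ := hmodel
  have hM' : M < 0 := neg_pos.1 hM
  have hW₀ : ∀ x, modelGradSq L M ri ro u x = slopeSq M (invProfile L M ri ro (u x)) := fun _ => rfl
  simp only [hW₀]
  have hψ := isProfileInverse_invProfile (L := L) hM' hri0 hro.le hri
  have hψle : ∀ t ∈ Ioo (modelProfile L M ro) (modelProfile L M ri),
      invProfile L M ri ro t ≤ ro := fun t ht =>
    ((invProfile_eq_iff hM'.le hri0 hro.le (Ioo_subset_Icc_self ht) _).1 rfl).1.2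
  obtain ⟨H, hH, hgrad⟩ := exists_isTorsionPotential hu.isOpen_ring hu.contDiffOn hu.laplacian_eq
  set Ω := ringDomain Ei Eo with hΩ
  have hmaps : MapsTo (u ∘ complexToPlane) (complexToPlane ⁻¹' Ω)
      (Ioo (modelProfile L M ro) (modelProfile L M ri)) := fun z hz => hbua _ hz
  have hbound : Bornology.IsBounded (complexToPlane ⁻¹' Ω) :=
    complexToPlane.isometry.antilipschitz.isBounded_preimage
      (hu.outer_domain.isBounded.subset sdiff_subset)
  have hfr : ∀ p ∈ frontier (complexToPlane ⁻¹' Ω), Tendsto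
      (fun z => torsionGradSq H z - slopeSq M (invProfile L M ri ro ((u ∘ complexToPlane) z)))
      (𝓝[complexToPlane ⁻¹' Ω] p) (𝓝 0) := fun p hp => by
    have hp' : complexToPlane p ∈ frontier Ω := by
      have hpre := complexToPlane.toHomeomorph.preimage_frontier Ω
      exact (hpre.symm ▸ hp : p ∈ complexToPlane.toHomeomorph ⁻¹' frontier Ω)
    have h1 := hu.tendsto_gradSq_sub_slopeSq hbua hM'.le hri0 hro.le hα hβ hp'
    have h2 : Tendsto complexToPlane (𝓝[complexToPlane ⁻¹' Ω] p) (𝓝[Ω] (complexToPlane p)) :=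
      complexToPlane.continuous.continuousWithinAt.tendsto_nhdsWithin (mapsTo_preimage _ _)
    refine (h1.comp h2).congr' ?_
    filter_upwards [self_mem_nhdsWithin] with z hz
    simp only [Function.comp_apply, hgrad z hz]
  have hle := hH.gradSq_le_slopeSq hψ hM' hbound hmaps hψle hfr
  refine ⟨fun x hx => ?_, ?_⟩
  · obtain ⟨z, rfl⟩ := complexToPlane.surjective x
    rw [← hgrad z hx]
    exact hle z hx
  · rintro ⟨x, hx, heq⟩
    obtain ⟨z, rfl⟩ := complexToPlane.surjective x
    set C := connectedComponentIn Ω (complexToPlane z) with hC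
    have hCΩ : C ⊆ Ω := connectedComponentIn_subset _ _
    have hHC := hH.mono (V' := complexToPlane ⁻¹' C)
      (hu.isOpen_ring.connectedComponentIn.preimage complexToPlane.continuous)
      (preimage_mono hCΩ)
    have hpre : IsPreconnected (complexToPlane ⁻¹' C) :=
      complexToPlane.toHomeomorph.isPreconnected_preimage.2 isPreconnected_connectedComponentIn
    have hmapsC := hmaps.mono_left (preimage_mono (f := complexToPlane) hCΩ)
    have hEq := hHC.gradSq_eq_slopeSq hψ hM' hmapsC hpre (fun w hw => hle w (hCΩ hw))
      (mem_connectedComponentIn hx) ((hgrad z hx).trans heq)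
    obtain ⟨c, hc⟩ := hHC.exists_center hψ hM' hmapsC hpre hEq
    refine hu.isRotationallySymmetric hbua hM'.le hri0 hro hx (c := complexToPlane c) fun y hy => ?_
    obtain ⟨w, rfl⟩ := complexToPlane.surjective y
    rw [complexToPlane.dist_map]
    exact hc w hy
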